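/- An instance $(G,s)$ of Set Cover or Set Partition consists of a bipartite graph $G=(F\,\dot\cup\,U,E)$, given by its adjacency matrix, with $|F|=m$ and $|U|=n$, and an integer $s\ge 0$; $N(f)\subseteq U$ denotes the neighbourhood of $f\in F$ and $N(S)=\bigcup_{f\in S}N(f)$. Set Cover asks whether there is $S\subseteq F$ with $N(S)=U$ and $|S|\le s$. Set Partition asks whether there is $S\subseteq F$ with $N(S)=U$, $|S|=s$, and $N(f)\cap N(f')=\emptyset$ for all distinct $f,f'\in S$. Theorem. For each of the two problems there are a deterministic algorithm, a constant $C>0$ and a polynomial $q$ such that the algorithm solves every instance in at most $$\max(m,1)\cdot q(n)\cdot 2^{\,n-\frac{n}{C\,\lg(\max(m/n,\,2))}}$$ steps (for $n=0$ the last factor is $1$). Here $\lg$ is the base-$2$ logarithm, and steps are counted on a word RAM with unit-cost instructions, for every word length that is at least some constant multiple (the constant depending only on the algorithm) of $n+\lg(m+1)+\lg(s+1)+1$ bits. In short: Set Cover and Set Partition can be solved in time $m\cdot\mathrm{poly}(n)\cdot 2^{\,n-n/O(\lg(m/n))}$. -/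

import Mathlib

/-- An instance of Set Cover or Set Partition: a bipartite graph with parts
`F = Fin m` (the family) and `U = Fin n` (the universe), and an integer `s`. -/
structure CoverInstance where
  /-- the number of elements of the universe -/
  n : ℕ
  /-- the number of sets of the family -/
  m : ℕ
  /-- the target solution size -/
  s : ℕ
  /-- the adjacency relation of the bipartite graph -/
  edge : Fin m → Fin n → Bool

namespace CoverInstance

/-- The neighbourhood `N(f)`, that is, the set represented by `f`. -/
def nbhd (I : CoverInstance) (f : Fin I.m) : Finset (Fin I.n) :=
  Finset.univ.filter fun u => I.edge f u = true

/-- The neighbourhood `N(S)` of a subfamily `S`. -/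
def nbhdOf (I : CoverInstance) (S : Finset (Fin I.m)) : Finset (Fin I.n) :=
  S.biUnion I.nbhd

/-- The Set Cover question: is `U` the union of at most `s` members of the family? -/
def HasSetCover (I : CoverInstance) : Prop :=
  ∃ S : Finset (Fin I.m), I.nbhdOf S = Finset.univ ∧ S.card ≤ I.s

/-- The Set Partition question: is `U` the union of exactly `s` pairwise disjoint members of
the family? -/
def HasSetPartition (I : CoverInstance) : Prop :=
  ∃ S : Finset (Fin I.m), I.nbhdOf S = Finset.univ ∧ S.card = I.s ∧
    ∀ f ∈ S, ∀ g ∈ S, f ≠ g → Disjoint (I.nbhd f) (I.nbhd g)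

end CoverInstance

/-! ### Deterministic word RAM -/

namespace WordRAM

/-- Binary operations on words. -/
inductive Op where
  | add | sub | mul | land | lor | lxor | shl | shr

/-- The value of an operation on `w`-bit words: results are reduced modulo `2 ^ w`;
subtraction is cut off at `0`. -/
def Op.eval (w : ℕ) : Op → ℕ → ℕ → ℕ
  | .add, a, b => (a + b) % 2 ^ w
  | .sub, a, b => (a - b) % 2 ^ w
  | .mul, a, b => (a * b) % 2 ^ w
  | .land, a, b => (a &&& b) % 2 ^ w
  | .lor, a, b => (a ||| b) % 2 ^ w
  | .lxor, a, b => (a ^^^ b) % 2 ^ w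
  | .shl, a, b => (a <<< b) % 2 ^ w
  | .shr, a, b => (a >>> b) % 2 ^ w

/-- Programs. Registers are named by natural numbers; a program mentions only finitely many. -/
inductive Prog where
  /-- `reg dst := k` -/
  | const (dst k : ℕ)
  /-- `reg dst := o (reg a) (reg b)` -/
  | op (o : Op) (dst a b : ℕ)
  /-- `reg dst := mem (reg addr)` -/
  | load (dst addr : ℕ)
  /-- `mem (reg addr) := reg src` -/
  | store (addr src : ℕ)
  /-- run `p`, then `q` -/
  | seq (p q : Prog)
  /-- if `reg r ≠ 0` run `p`, otherwise run `q` -/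
  | branch (r : ℕ) (p q : Prog)
  /-- while `reg r ≠ 0` run `p` -/
  | loop (r : ℕ) (p : Prog)

/-- The contents of the registers and of the random access memory. -/
structure State where
  /-- registers -/
  reg : ℕ → ℕ
  /-- memory cells -/
  mem : ℕ → ℕ

/-- Write `x` to register `d`. -/
def State.setReg (σ : State) (d x : ℕ) : State :=
  { σ with reg := Function.update σ.reg d x }

/-- Write `x` to memory cell `a`. -/
def State.setMem (σ : State) (a x : ℕ) : State :=
  { σ with mem := Function.update σ.mem a x }

/-- `Exec w p σ t τ`: with word length `w`, the program `p` started in the state `σ` halts in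
the state `τ` after exactly `t` steps. Every elementary instruction and every evaluation of
the test of a branch or of a loop is one step. -/
inductive Exec (w : ℕ) : Prog → State → ℕ → State → Prop where
  | const (σ : State) (d k : ℕ) :
      Exec w (.const d k) σ 1 (σ.setReg d (k % 2 ^ w))
  | op (σ : State) (o : Op) (d a b : ℕ) :
      Exec w (.op o d a b) σ 1 (σ.setReg d (o.eval w (σ.reg a) (σ.reg b)))
  | load (σ : State) (d a : ℕ) :
      Exec w (.load d a) σ 1 (σ.setReg d (σ.mem (σ.reg a)))
  | store (σ : State) (a b : ℕ) :
      Exec w (.store a b) σ 1 (σ.setMem (σ.reg a) (σ.reg b))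
  | seq {p q : Prog} {σ τ ρ : State} {t₁ t₂ : ℕ} :
      Exec w p σ t₁ τ → Exec w q τ t₂ ρ → Exec w (.seq p q) σ (t₁ + t₂) ρ
  | branch_pos {r : ℕ} {p q : Prog} {σ τ : State} {t : ℕ} :
      σ.reg r ≠ 0 → Exec w p σ t τ → Exec w (.branch r p q) σ (1 + t) τ
  | branch_zero {r : ℕ} {p q : Prog} {σ τ : State} {t : ℕ} :
      σ.reg r = 0 → Exec w q σ t τ → Exec w (.branch r p q) σ (1 + t) τ
  | loop_pos {r : ℕ} {p : Prog} {σ τ ρ : State} {t₁ t₂ : ℕ} :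
      σ.reg r ≠ 0 → Exec w p σ t₁ τ → Exec w (.loop r p) τ t₂ ρ →
        Exec w (.loop r p) σ (1 + t₁ + t₂) ρ
  | loop_zero {r : ℕ} {p : Prog} {σ : State} :
      σ.reg r = 0 → Exec w (.loop r p) σ 1 σ

/-- The initial state on input `I`: the registers `0`, `1`, `2` hold `n`, `m`, `s`, and the
memory cell `f * n + u` holds the entry `(f, u)` of the `m × n` adjacency matrix. All other
registers and cells are `0`. -/
def input (I : CoverInstance) : State where
  reg := fun i => if i = 0 then I.n else if i = 1 then I.m else if i = 2 then I.s else 0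
  mem := fun a =>
    if ∃ (f : Fin I.m) (u : Fin I.n), a = f.val * I.n + u.val ∧ I.edge f u = true then 1 else 0

/-- The problem `P` is solved by a single deterministic word RAM program that makes at most
`T I` steps on every instance `I`, for every word length that is at least a constant multiple
of `n + log m + log s` bits (so that words can index subsets of the universe and hold the
numbers `m` and `s`). The answer is left in register `0`: `1` for YES, `0` for NO. -/
def SolvableInTime (P : CoverInstance → Prop) (T : CoverInstance → ℝ) : Prop :=
  ∃ (p : Prog) (c : ℕ), ∀ (I : CoverInstance) (w : ℕ),
    c * (I.n + Nat.size I.m + Nat.size I.s + 1) ≤ w →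
      ∃ (t : ℕ) (τ : State), Exec w p (input I) t τ ∧
        (P I → τ.reg 0 = 1) ∧ (¬ P I → τ.reg 0 = 0) ∧ (t : ℝ) ≤ T I

end WordRAM

/-- The time bound `m · q(n) · 2 ^ (n - n / (C · lg (m / n)))`. The ratio `m / n` is replaced
by `2` where it is smaller, and the factor `m` by `1` where `m = 0`. -/
noncomputable def fewSetsTime (C : ℝ) (q : Polynomial ℕ) (I : CoverInstance) : ℝ :=
  max (I.m : ℝ) 1 * ((q.eval I.n : ℕ) : ℝ) *
    (2 : ℝ) ^ ((I.n : ℝ) - (I.n : ℝ) / (C * Real.logb 2 (max ((I.m : ℝ) / (I.n : ℝ)) 2)))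

/-! Build a solution greedily: whenever the union `X` of the sets chosen so far is not the whole
universe, the next set must contain the least missing element. Any cover contains a subcover
obtained in this way, and for partitions the sets left out are empty. So it suffices to explore all
reachable states `(j, X)`, with `j` the number of sets used, by a graph search that spends `O(m n)`
steps (plus a constant) per state. The exponential factor is the number of reachable states.

To bound that number, fix `k` and call a chosen set large if it adds at least `2 * k` new elements.
The large sets form a family `A` whose union `B` has at least `2 * k * |A|` elements; the other sets
add at most `2 * k * j` elements, so `X` contains `B` and exceeds it by at most that much. Moreover
`X` contains the first `j` elements of the universe. If `j` is of order at least `n / k`, the forced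
prefix saves a factor `2 ^ (n / (16 * k))`; if `j` is smaller, `X \ B` is small and there are few
choices for it. Both cases save a further `2 ^ (k * |A|)` because of `B` (`card_layer_le`). Summing
over all `A` costs `(1 + 2 ^ (-k)) ^ m` (`card_reach_le`), which is negligible once `k` is a
suitable multiple of `lg (m / n)` (`card_reach_le_two_pow`).

The rest is an implementation on the word RAM: a state is packed into one word of `2 * n` bits, a
table marks the words already seen, and a stack holds those still to be expanded. -/

namespace CoverInstance

/-! ### Greedy chains of sets and their relation to covers and partitions. -/

variable {I : CoverInstance} {d : Bool}

/-- `Reach I d j X`: the set `X` is the union of `j` sets, each of which contains the least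
element missed by the sets before it (and is disjoint from those sets if `d` holds). -/
inductive Reach (I : CoverInstance) (d : Bool) : ℕ → Finset (Fin I.n) → Prop
  | nil : Reach I d 0 ∅
  | cons {j : ℕ} {X : Finset (Fin I.n)} (u : Fin I.n) (f : Fin I.m) :
      Reach I d j X → u ∉ X → (∀ v < u, v ∈ X) → u ∈ I.nbhd f →
        (d = true → Disjoint X (I.nbhd f)) → Reach I d (j + 1) (X ∪ I.nbhd f)

theorem Reach.le_card {j : ℕ} {X : Finset (Fin I.n)} (h : Reach I d j X) : j ≤ X.card := by
  induction h with
  | nil => simp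
  | @cons j X u f _ hu _ huf _ ih =>
    have : X ⊂ X ∪ I.nbhd f :=
      Finset.ssubset_iff_subset_ne.2 ⟨Finset.subset_union_left, fun h => hu (by
        rw [h]; exact Finset.mem_union_right _ huf)⟩
    have := Finset.card_lt_card this
    omega

theorem Reach.le_n {j : ℕ} {X : Finset (Fin I.n)} (h : Reach I d j X) : j ≤ I.n :=
  h.le_card.trans (by simpa using Finset.card_le_univ X)

/-- Each step fills the least gap, so the initial segment contained in the union grows by at least
one element per step. -/
theorem Reach.prefix_subset {j : ℕ} {X : Finset (Fin I.n)} (h : Reach I d j X) :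
    ∀ v : Fin I.n, v.val < j → v ∈ X := by
  induction h with
  | nil => simp
  | @cons j X u f _ hu hlt huf _ ih =>
    intro v hv
    by_contra hvX
    rw [Finset.mem_union, not_or] at hvX
    have h1 : ¬ v.val < j := fun h => hvX.1 (ih v h)
    have h2 : ¬ u.val < j := fun h => hu (ih u h)
    have h3 : ¬ v < u := fun h => hvX.1 (hlt v h)
    have h4 : v = u := by
      rw [Fin.lt_def] at h3
      exact Fin.ext (by omega)
    exact hvX.2 (h4 ▸ huf)

/-- A path decomposes into a family `A` of sets that contribute at least `K` new elements
each, and sets that contribute fewer than `K` new elements. -/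
theorem Reach.exists_large {j : ℕ} {X : Finset (Fin I.n)} (h : Reach I d j X) (K : ℕ) :
    ∃ A : Finset (Fin I.m), I.nbhdOf A ⊆ X ∧ K * A.card ≤ (I.nbhdOf A).card ∧
      X.card ≤ (I.nbhdOf A).card + K * j := by
  induction h with
  | nil => exact ⟨∅, by simp [nbhdOf]⟩
  | @cons j X u f _ hu hlt huf _ ih =>
    obtain ⟨A, hAX, hK, hX⟩ := ih
    have hcard : (X ∪ I.nbhd f).card = X.card + (I.nbhd f \ X).card := by
      rw [← Finset.union_sdiff_self_eq_union, Finset.card_union_of_disjoint Finset.disjoint_sdiff]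
    -- A set that is large relative to `X` is at least as large relative to the smaller set `nbhdOf
    -- A`, so it may join `A`. A small set is paid for by the term `K * j`.
    rcases le_or_gt K (I.nbhd f \ X).card with hl | hs
    · refine ⟨insert f A, ?_, ?_, ?_⟩
      · rw [nbhdOf, Finset.biUnion_insert, Finset.union_comm]
        exact Finset.union_subset_union_left hAX
      all_goals
        have h1 : (I.nbhdOf (insert f A)).card =
            (I.nbhdOf A).card + (I.nbhd f \ I.nbhdOf A).card := by
          rw [nbhdOf, Finset.biUnion_insert, Finset.union_comm,
            ← Finset.union_sdiff_self_eq_union,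
            Finset.card_union_of_disjoint Finset.disjoint_sdiff]
          rfl
        have h2 : (I.nbhd f \ X).card ≤ (I.nbhd f \ I.nbhdOf A).card :=
          Finset.card_le_card (Finset.sdiff_subset_sdiff le_rfl hAX)
        have h3 := Finset.card_insert_le f A
      · nlinarith
      · nlinarith
    · exact ⟨A, hAX.trans Finset.subset_union_left, hK, by nlinarith⟩

/-- Each set on the path contributes an element not covered before, so the sets are nonempty and
distinct, and a path of length `j` uses exactly `j` of them. -/
theorem Reach.exists_family {j : ℕ} {X : Finset (Fin I.n)} (h : Reach I d j X) :
    ∃ T : Finset (Fin I.m), T.card = j ∧ I.nbhdOf T = X ∧ (∀ f ∈ T, (I.nbhd f).Nonempty) ∧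
      (d = true → ∀ f ∈ T, ∀ g ∈ T, f ≠ g → Disjoint (I.nbhd f) (I.nbhd g)) := by
  induction h with
  | nil => exact ⟨∅, by simp [nbhdOf]⟩
  | @cons j X u f _ hu hlt huf hd ih =>
    obtain ⟨T, hT, hX, hne, hdis⟩ := ih
    have hfT : f ∉ T := fun h => hu (hX ▸ Finset.mem_biUnion.2 ⟨f, h, huf⟩)
    have hsub : ∀ g ∈ T, I.nbhd g ⊆ X := fun g hg => hX ▸ Finset.subset_biUnion_of_mem I.nbhd hg
    refine ⟨insert f T, by rw [Finset.card_insert_of_notMem hfT, hT], ?_, ?_, ?_⟩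
    · rw [← hX, nbhdOf, Finset.biUnion_insert, Finset.union_comm]; rfl
    · intro g hg
      rcases Finset.mem_insert.1 hg with rfl | hg
      exacts [⟨u, huf⟩, hne g hg]
    · intro hd' g hg g' hg' hgg
      rcases Finset.mem_insert.1 hg with h | hgT <;> rcases Finset.mem_insert.1 hg' with h' | hgT'
      · exact absurd (h.trans h'.symm) hgg
      · exact h ▸ ((hd hd').mono_left (hsub _ hgT')).symm
      · exact h' ▸ (hd hd').mono_left (hsub _ hgT)
      · exact hdis hd' g hgT g' hgT' hgg

/-- Starting from nothing, repeatedly add a member of `S` that contains the least uncovered element;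
the induction is on the number of uncovered elements. -/
theorem exists_reach_univ {S : Finset (Fin I.m)} (hS : I.nbhdOf S = Finset.univ)
    (hd : d = true → ∀ f ∈ S, ∀ g ∈ S, f ≠ g → Disjoint (I.nbhd f) (I.nbhd g)) :
    ∃ T ⊆ S, I.nbhdOf T = Finset.univ ∧ Reach I d T.card Finset.univ := by
  suffices H : ∀ (k : ℕ) (T : Finset (Fin I.m)), T ⊆ S → (I.nbhdOf T)ᶜ.card = k →
      Reach I d T.card (I.nbhdOf T) →
      ∃ T ⊆ S, I.nbhdOf T = Finset.univ ∧ Reach I d T.card Finset.univ from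
    H _ ∅ (by simp) rfl (by simpa [nbhdOf] using Reach.nil)
  intro k
  induction k using Nat.strong_induction_on with
  | _ k ih =>
  intro T hTS hk hT
  by_cases hne : (I.nbhdOf T)ᶜ.Nonempty
  · set u := (I.nbhdOf T)ᶜ.min' hne with hu
    have huT : u ∉ I.nbhdOf T := Finset.mem_compl.1 (Finset.min'_mem _ hne)
    obtain ⟨f, hfS, huf⟩ := Finset.mem_biUnion.1 (hS ▸ Finset.mem_univ u : u ∈ I.nbhdOf S)
    have hfT : f ∉ T := fun h => huT (Finset.mem_biUnion.2 ⟨f, h, huf⟩)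
    have heq : I.nbhdOf (insert f T) = I.nbhdOf T ∪ I.nbhd f := by
      rw [nbhdOf, Finset.biUnion_insert, Finset.union_comm]; rfl
    refine ih _ ?_ (insert f T) (Finset.insert_subset hfS hTS) rfl ?_
    · rw [← hk]
      refine Finset.card_lt_card (Finset.ssubset_iff_subset_ne.2 ⟨?_, fun h => ?_⟩)
      · rw [heq, Finset.compl_subset_compl]
        exact Finset.subset_union_left
      · have : u ∈ (I.nbhdOf (insert f T))ᶜ := h ▸ Finset.min'_mem _ hne
        rw [heq, Finset.mem_compl] at this
        exact this (Finset.mem_union_right _ huf)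
    · rw [heq, Finset.card_insert_of_notMem hfT]
      refine hT.cons u f huT (fun v hv => ?_) huf fun hd' => ?_
      · by_contra hvT
        exact absurd (Finset.min'_le _ v (Finset.mem_compl.2 hvT)) (not_le.2 hv)
      · rw [nbhdOf, Finset.disjoint_biUnion_left]
        exact fun g hg => hd hd' g (hTS hg) f hfS fun h => hfT (h ▸ hg)
  · have : I.nbhdOf T = Finset.univ := by
      rwa [Finset.not_nonempty_iff_eq_empty, Finset.compl_eq_empty_iff] at hne
    exact ⟨T, hTS, this, this ▸ hT⟩

/-- The number of empty sets in the family. -/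
def emptyCount (I : CoverInstance) : ℕ :=
  (Finset.univ.filter fun f => I.nbhd f = ∅).card

/-- The condition under which a path of length `j` that covers the universe is a witness. -/
def Accepts (I : CoverInstance) (d : Bool) (j : ℕ) : Prop :=
  j ≤ I.s ∧ (d = true → I.s ≤ j + I.emptyCount)

theorem hasSetCover_iff :
    I.HasSetCover ↔ ∃ j, Reach I false j Finset.univ ∧ I.Accepts false j := by
  constructor
  · rintro ⟨S, hS, hs⟩
    obtain ⟨T, hTS, -, hT⟩ := exists_reach_univ (d := false) hS (by simp)
    exact ⟨_, hT, (Finset.card_le_card hTS).trans hs, by simp⟩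
  · rintro ⟨j, hj, hjs, -⟩
    obtain ⟨T, hT, hX, -⟩ := hj.exists_family
    exact ⟨T, hX, hT ▸ hjs⟩

theorem hasSetPartition_iff :
    I.HasSetPartition ↔ ∃ j, Reach I true j Finset.univ ∧ I.Accepts true j := by
  constructor
  · rintro ⟨S, hS, hs, hdis⟩
    obtain ⟨T, hTS, hTU, hT⟩ := exists_reach_univ (d := true) hS fun _ => hdis
    refine ⟨_, hT, hs ▸ Finset.card_le_card hTS, fun _ => ?_⟩
    -- The members of `S` outside `T` are disjoint from a family that already covers everything,
    -- hence empty. Conversely, empty sets can pad a path to the exact size `s`.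
    rw [← hs, ← Finset.card_sdiff_add_card_eq_card hTS, add_comm]
    refine Nat.add_le_add_left (Finset.card_le_card fun g hg => ?_) _
    obtain ⟨hgS, hgT⟩ := Finset.mem_sdiff.1 hg
    rw [Finset.mem_filter]
    refine ⟨Finset.mem_univ _, Finset.eq_empty_of_forall_notMem fun v hv => ?_⟩
    obtain ⟨f, hfT, hvf⟩ := Finset.mem_biUnion.1 (hTU ▸ Finset.mem_univ v : v ∈ I.nbhdOf T)
    exact Finset.disjoint_left.1 (hdis g hgS f (hTS hfT) fun h => hgT (h ▸ hfT)) hv hvf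
  · rintro ⟨j, hj, hjs, hsj⟩
    obtain ⟨T, hT, hX, hne, hdis⟩ := hj.exists_family
    obtain ⟨E, hE, hEc⟩ := Finset.exists_subset_card_eq
      (show I.s - j ≤ (Finset.univ.filter fun f => I.nbhd f = ∅).card from by
        have := hsj rfl; rw [emptyCount] at this; omega)
    have hE0 : ∀ f ∈ E, I.nbhd f = ∅ := fun f hf => (Finset.mem_filter.1 (hE hf)).2
    have hTE : Disjoint T E := Finset.disjoint_left.2 fun f hfT hfE =>
      (hne f hfT).ne_empty (hE0 f hfE)
    refine ⟨T ∪ E, ?_, ?_, ?_⟩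
    · refine Finset.eq_univ_of_forall fun v => ?_
      obtain ⟨f, hfT, hvf⟩ := Finset.mem_biUnion.1 (hX ▸ Finset.mem_univ v : v ∈ I.nbhdOf T)
      exact Finset.mem_biUnion.2 ⟨f, Finset.mem_union_left _ hfT, hvf⟩
    · rw [Finset.card_union_of_disjoint hTE, hT, hEc]; omega
    · intro f hf g hg hfg
      rcases Finset.mem_union.1 hf with hf | hf
      · rcases Finset.mem_union.1 hg with hg | hg
        · exact hdis rfl f hf g hg hfg
        · simp [hE0 g hg]
      · simp [hE0 f hf]

end CoverInstance

/-! ### Bounding the number of reachable states. -/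

theorem three_halves_pow_le (a : ℕ) : (3 / 2 : ℝ) ^ a ≤ (2 : ℝ) ^ (5 / 8 * (a : ℝ)) := by
  have h : (3 / 2 : ℝ) ≤ (2 : ℝ) ^ (5 / 8 : ℝ) := by
    -- Eighth powers turn this into `3 ^ 8 / 2 ^ 8 ≤ 2 ^ 5`.
    refine le_of_pow_le_pow_left₀ (n := 8) (by norm_num) (by positivity) ?_
    rw [← Real.rpow_natCast ((2 : ℝ) ^ (5 / 8 : ℝ)), ← Real.rpow_mul (by norm_num)]
    norm_num
  rw [Real.rpow_mul (by norm_num), Real.rpow_natCast]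
  exact pow_le_pow_left₀ (by norm_num) h a

theorem one_add_pow_le {x : ℝ} (hx : 0 ≤ x) (a : ℕ) :
    (1 + x) ^ a ≤ (2 : ℝ) ^ (2 * (a * x)) := by
  have h : 1 + x ≤ (2 : ℝ) ^ (2 * x) := by
    have h4 : Real.exp 1 ≤ 4 := by linarith [Real.exp_one_lt_d9]
    calc 1 + x ≤ Real.exp x := by linarith [Real.add_one_le_exp x]
      _ = Real.exp 1 ^ x := by rw [← Real.exp_mul, one_mul]
      _ ≤ 4 ^ x := Real.rpow_le_rpow (Real.exp_pos 1).le h4 hx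
      _ = (2 : ℝ) ^ (2 * x) := by
        rw [Real.rpow_mul (by norm_num)]; norm_num
  calc (1 + x) ^ a ≤ ((2 : ℝ) ^ (2 * x)) ^ a := pow_le_pow_left₀ (by linarith) h a
    _ = _ := by rw [← Real.rpow_natCast, ← Real.rpow_mul (by norm_num)]; ring_nf

theorem card_filter_le_of_prefix {n : ℕ} (B : Finset (Fin n)) {j : ℕ} (hj : j ≤ n) :
    ((Finset.univ.filter fun X : Finset (Fin n) =>
      B ⊆ X ∧ ∀ v : Fin n, v.val < j → v ∈ X).card : ℝ) ≤
      (2 : ℝ) ^ ((n : ℝ) - (B.card + j) / 2) := by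
  set P : Finset (Fin n) := Finset.univ.filter fun v => v.val < j with hP
  have hPc : j ≤ P.card := by
    have : Finset.univ.map (Fin.castLEEmb hj) ⊆ P := by
      intro v hv
      obtain ⟨i, -, rfl⟩ := Finset.mem_map.1 hv
      simp [hP]
    simpa using Finset.card_le_card this
  have h1 : (Finset.univ.filter fun X : Finset (Fin n) =>
      B ⊆ X ∧ ∀ v : Fin n, v.val < j → v ∈ X) ⊆ Finset.Icc (B ∪ P) Finset.univ := by
    intro X hX
    obtain ⟨hB, hv⟩ := (Finset.mem_filter.1 hX).2
    exact Finset.mem_Icc.2 ⟨Finset.union_subset hB fun v h => hv v (Finset.mem_filter.1 h).2,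
      Finset.subset_univ _⟩
  have h2 := Finset.card_le_card h1
  rw [Finset.card_Icc_finset (Finset.subset_univ _), Finset.card_univ, Fintype.card_fin] at h2
  have hle : (B ∪ P).card ≤ n := by simpa using Finset.card_le_univ (B ∪ P)
  have hb : B.card ≤ (B ∪ P).card := Finset.card_le_card Finset.subset_union_left
  have hp : P.card ≤ (B ∪ P).card := Finset.card_le_card Finset.subset_union_right
  -- `B` and the prefix may overlap; their union has at least the average of the two sizes.
  have h3 : (2 * (B ∪ P).card : ℝ) ≥ B.card + j := by exact_mod_cast (by omega)
  calc _ ≤ ((2 ^ (n - (B ∪ P).card) : ℕ) : ℝ) := by exact_mod_cast h2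
    _ = (2 : ℝ) ^ ((n : ℝ) - (B ∪ P).card) := by
      rw [← Nat.cast_sub hle, Real.rpow_natCast]; push_cast; rfl
    _ ≤ _ := Real.rpow_le_rpow_of_exponent_le (by norm_num) (by linarith)

theorem card_filter_le_of_card {n : ℕ} (B : Finset (Fin n)) (r : ℕ) :
    ((Finset.univ.filter fun X : Finset (Fin n) => B ⊆ X ∧ X.card ≤ B.card + r).card : ℝ) ≤
      (2 : ℝ) ^ ((r : ℝ) + 5 / 8 * ((n : ℝ) - B.card)) := by
  set S := Finset.univ.filter fun X : Finset (Fin n) => B ⊆ X ∧ X.card ≤ B.card + r with hS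
  have hS' : ∀ X ∈ S, B ⊆ X ∧ X.card ≤ B.card + r := fun X hX => (Finset.mem_filter.1 hX).2
  have hinj : Set.InjOn (fun X : Finset (Fin n) => X \ B) S := by
    intro X hX Y hY h
    rw [← Finset.union_sdiff_of_subset (hS' X hX).1, ← Finset.union_sdiff_of_subset (hS' Y hY).1]
    exact congrArg (B ∪ ·) h
  have hn : B.card ≤ n := by simpa using Finset.card_le_univ B
  calc (S.card : ℝ) = ∑ X ∈ S, 1 := by simp
    -- A Chernoff-type weight: it is at least `1` on every set that is counted, and its sum over all
    -- subsets of the complement of `B` is a binomial sum.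
    _ ≤ ∑ X ∈ S, (2 : ℝ) ^ r * (1 / 2) ^ (X \ B).card := by
      refine Finset.sum_le_sum fun X hX => ?_
      obtain ⟨hB, hc⟩ := hS' X hX
      have : (X \ B).card ≤ r := by rw [Finset.card_sdiff_of_subset hB]; omega
      calc (1 : ℝ) = 2 ^ r * (1 / 2) ^ r := by rw [← mul_pow]; norm_num
        _ ≤ _ := mul_le_mul_of_nonneg_left
          (pow_le_pow_of_le_one (by norm_num) (by norm_num) this) (by positivity)
    _ = ∑ Y ∈ S.image (· \ B), (2 : ℝ) ^ r * (1 / 2) ^ Y.card := 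
      (Finset.sum_image (f := fun Y : Finset (Fin n) => (2 : ℝ) ^ r * (1 / 2) ^ Y.card) hinj).symm
    _ ≤ ∑ Y ∈ Bᶜ.powerset, (2 : ℝ) ^ r * (1 / 2) ^ Y.card := by
      refine Finset.sum_le_sum_of_subset_of_nonneg (fun Y hY => ?_) fun _ _ _ => by positivity
      obtain ⟨X, -, rfl⟩ := Finset.mem_image.1 hY
      rw [Finset.mem_powerset]
      intro v hv
      exact Finset.mem_compl.2 (Finset.mem_sdiff.1 hv).2
    _ = 2 ^ r * (3 / 2) ^ (n - B.card) := by
      rw [← Finset.mul_sum]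
      have := Finset.sum_pow_mul_eq_add_pow (1 / 2 : ℝ) 1 Bᶜ
      simp only [one_pow, mul_one, Finset.card_compl, Fintype.card_fin] at this
      rw [this]; norm_num
    _ ≤ 2 ^ r * 2 ^ (5 / 8 * ((n - B.card : ℕ) : ℝ)) :=
      mul_le_mul_of_nonneg_left (three_halves_pow_le _) (by positivity)
    _ = _ := by
      rw [← Real.rpow_natCast 2 r, ← Real.rpow_add (by norm_num), Nat.cast_sub hn]

namespace CoverInstance

variable {I : CoverInstance} {d : Bool}

/-- Here `B` is the union of `i` large sets. A large `j` is exploited through the forced prefix, a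
small `j` through the small size of `X \ B`; the threshold is `j = n / (8 * k)`. -/
theorem card_layer_le {n : ℕ} (B : Finset (Fin n)) {j k i : ℕ} (hj : j ≤ n) (hk : 1 ≤ k)
    (hB : 2 * k * i ≤ B.card) :
    ((Finset.univ.filter fun X : Finset (Fin n) =>
      B ⊆ X ∧ (∀ v : Fin n, v.val < j → v ∈ X) ∧ X.card ≤ B.card + 2 * k * j).card : ℝ) ≤
      (2 : ℝ) ^ ((n : ℝ) - n / (16 * k) - k * i) := by
  have hk' : (1 : ℝ) ≤ k := by exact_mod_cast hk
  have hB' : 2 * (k : ℝ) * i ≤ B.card := by exact_mod_cast hB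
  rcases le_or_gt n (8 * k * j) with h | h
  · have h' : (n : ℝ) ≤ 8 * k * j := by exact_mod_cast h
    have h1 : (n : ℝ) / (16 * k) ≤ j / 2 := by
      rw [div_le_iff₀ (by positivity)]; linarith
    refine le_trans ?_ ((card_filter_le_of_prefix B hj).trans
      (Real.rpow_le_rpow_of_exponent_le (by norm_num) ?_))
    · exact_mod_cast Finset.card_le_card fun X => by
        simp only [Finset.mem_filter]; tauto
    · linarith
  · have h' : 8 * (k : ℝ) * j ≤ n := by exact_mod_cast h.le
    have h1 : (n : ℝ) / (16 * k) ≤ n / 16 :=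
      div_le_div_of_nonneg_left (by positivity) (by norm_num) (by linarith)
    refine le_trans ?_ ((card_filter_le_of_card B (2 * k * j)).trans
      (Real.rpow_le_rpow_of_exponent_le (by norm_num) ?_))
    · exact_mod_cast Finset.card_le_card fun X => by
        simp only [Finset.mem_filter]; tauto
    -- Below the threshold `2 * k * j ≤ n / 4`, so the exponent is at most `7 * n / 8 - 5 / 8 *
    -- |B|`, and `5 / 8 * |B| ≥ k * i`.
    · push_cast
      have hn : (0 : ℝ) ≤ n := by positivity
      linarith

/-- Every state is charged to its family of large sets and its length. The saving `2 ^ (-k * |A|)`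
is what makes the sum over all `A` affordable: by the binomial theorem it is `(1 + 2 ^ (-k)) ^ m`.
-/
theorem card_reach_le (R : Finset (ℕ × Finset (Fin I.n))) (hR : ∀ x ∈ R, Reach I d x.1 x.2)
    {k : ℕ} (hk : 1 ≤ k) :
    (R.card : ℝ) ≤ (I.n + 1) * (2 : ℝ) ^ ((I.n : ℝ) - I.n / (16 * k)) *
      (1 + (2 : ℝ) ^ (-(k : ℝ))) ^ I.m := by
  set L : Finset (Fin I.m) → ℕ → Finset (Finset (Fin I.n)) := fun A j =>
    Finset.univ.filter fun X => I.nbhdOf A ⊆ X ∧ (∀ v : Fin I.n, v.val < j → v ∈ X) ∧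
      X.card ≤ (I.nbhdOf A).card + 2 * k * j with hL
  set D : Finset (Finset (Fin I.m)) :=
    Finset.univ.filter fun A => 2 * k * A.card ≤ (I.nbhdOf A).card with hD
  have hsub : R ⊆ D.biUnion fun A => (Finset.range (I.n + 1)).biUnion fun j =>
      (L A j).image fun X => (j, X) := by
    rintro ⟨j, X⟩ hx
    have h := hR _ hx
    obtain ⟨A, h1, h2, h3⟩ := h.exists_large (2 * k)
    simp only [Finset.mem_biUnion, Finset.mem_image, hD, Finset.mem_filter, hL, Finset.mem_univ,
      true_and]
    exact ⟨A, h2, j, Finset.mem_range.2 (Nat.lt_succ_of_le h.le_n), X,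
      ⟨h1, h.prefix_subset, h3⟩, rfl⟩
  have hlayer : ∀ A ∈ D, ∀ j ∈ Finset.range (I.n + 1), ((L A j).card : ℝ) ≤
      (2 : ℝ) ^ ((I.n : ℝ) - I.n / (16 * k)) * ((2 : ℝ) ^ (-(k : ℝ))) ^ A.card := by
    intro A hA j hj
    have := card_layer_le (I.nbhdOf A) (Nat.lt_succ_iff.1 (Finset.mem_range.1 hj)) hk
      (Finset.mem_filter.1 hA).2
    rwa [sub_eq_add_neg _ ((k : ℝ) * _), Real.rpow_add (by norm_num), ← neg_mul,
      Real.rpow_mul (by norm_num), Real.rpow_natCast] at this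
  calc (R.card : ℝ) ≤ ((∑ A ∈ D, ∑ j ∈ Finset.range (I.n + 1), (L A j).card : ℕ) : ℝ) := by
        exact_mod_cast (Finset.card_le_card hsub).trans (Finset.card_biUnion_le.trans
          (Finset.sum_le_sum fun A _ => Finset.card_biUnion_le.trans
            (Finset.sum_le_sum fun j _ => Finset.card_image_le)))
    _ = ∑ A ∈ D, ∑ j ∈ Finset.range (I.n + 1), ((L A j).card : ℝ) := by push_cast; rfl
    _ ≤ ∑ A ∈ D, ∑ j ∈ Finset.range (I.n + 1),
        (2 : ℝ) ^ ((I.n : ℝ) - I.n / (16 * k)) * ((2 : ℝ) ^ (-(k : ℝ))) ^ A.card :=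
      Finset.sum_le_sum fun A hA => Finset.sum_le_sum fun j hj => hlayer A hA j hj
    _ ≤ ∑ A : Finset (Fin I.m), ∑ j ∈ Finset.range (I.n + 1),
        (2 : ℝ) ^ ((I.n : ℝ) - I.n / (16 * k)) * ((2 : ℝ) ^ (-(k : ℝ))) ^ A.card :=
      Finset.sum_le_sum_of_subset_of_nonneg (Finset.subset_univ _) fun _ _ _ => by positivity
    _ = _ := by
      have := Fintype.sum_pow_mul_eq_add_pow (Fin I.m) ((2 : ℝ) ^ (-(k : ℝ))) 1
      simp only [one_pow, mul_one, Fintype.card_fin] at this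
      rw [add_comm 1, ← this]
      simp only [Finset.sum_const, Finset.card_range, nsmul_eq_mul, ← Finset.mul_sum]
      push_cast; ring

theorem mul_add_le_two_pow (κ : ℕ) : 64 * (2 * κ + 10) ≤ 2 ^ 10 * 2 ^ κ := by
  induction κ with
  | zero => norm_num
  | succ a ih => rw [pow_succ]; have := Nat.one_le_two_pow (n := a); omega

theorem card_reach_le_two_pow (R : Finset (ℕ × Finset (Fin I.n)))
    (hR : ∀ x ∈ R, Reach I d x.1 x.2) :
    (R.card : ℝ) ≤ (I.n + 1) * (2 : ℝ) ^ ((I.n : ℝ) -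
      (I.n : ℝ) / (448 * Real.logb 2 (max ((I.m : ℝ) / (I.n : ℝ)) 2))) := by
  set M : ℝ := max ((I.m : ℝ) / (I.n : ℝ)) 2 with hM
  have hM2 : 2 ≤ M := le_max_right _ _
  set L : ℝ := Real.logb 2 M with hL
  have hL1 : 1 ≤ L := by
    rw [hL, Real.le_logb_iff_rpow_le (by norm_num) (by linarith), Real.rpow_one]; exact hM2
  set κ : ℕ := ⌈L⌉₊ with hκ
  have hκL : L ≤ κ := Nat.le_ceil L
  have hκL' : (κ : ℝ) ≤ L + 1 := (Nat.ceil_lt_add_one (by linarith)).le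
  have hMκ : M ≤ 2 ^ κ := by
    rw [← Real.rpow_natCast, ← Real.logb_le_iff_le_rpow (by norm_num) (by linarith)]; exact hκL
  -- In `2 ^ k = 2 ^ κ * (2 ^ 10 * 2 ^ κ)` the first factor absorbs `m / n` and the second absorbs
  -- `64 * k`. Since `k ≤ 14 * L`, the final constant is `448 = 32 * 14`.
  set k : ℕ := 2 * κ + 10 with hk
  have hkL : (k : ℝ) ≤ 14 * L := by rw [hk]; push_cast; linarith
  have hk0 : (0 : ℝ) < k := by rw [hk]; positivity
  have hn : (0 : ℝ) ≤ I.n := by positivity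
  have hm : (I.m : ℝ) * (2 : ℝ) ^ (-(k : ℝ)) * (64 * k) ≤ I.n ∨ I.n = 0 := by
    rcases Nat.eq_zero_or_pos I.n with h0 | h0
    · exact Or.inr h0
    left
    have hn' : (0 : ℝ) < I.n := by exact_mod_cast h0
    have h1 : (I.m : ℝ) ≤ 2 ^ κ * I.n := by
      rw [← div_le_iff₀ hn']; exact (le_max_left _ _).trans hMκ
    have h2 : (64 * k : ℝ) ≤ 2 ^ 10 * 2 ^ κ := by exact_mod_cast mul_add_le_two_pow κ
    have h3 : (2 : ℝ) ^ k = 2 ^ κ * (2 ^ 10 * 2 ^ κ) := by rw [hk]; ring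
    rw [Real.rpow_neg (by norm_num), Real.rpow_natCast, mul_assoc, mul_comm, mul_assoc,
      inv_mul_le_iff₀ (by positivity), h3]
    calc 64 * (k : ℝ) * I.m ≤ (2 ^ 10 * 2 ^ κ) * (2 ^ κ * I.n) := by gcongr
      _ = _ := by ring
  rcases hm with hm | h0
  · refine (card_reach_le R hR (show 1 ≤ k by omega)).trans ?_
    rw [mul_assoc]
    refine mul_le_mul_of_nonneg_left ?_ (by positivity)
    refine (mul_le_mul_of_nonneg_left (one_add_pow_le (by positivity) I.m)
      (by positivity)).trans ?_
    rw [← Real.rpow_add (by norm_num)]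
    refine Real.rpow_le_rpow_of_exponent_le (by norm_num) ?_
    have h1 : (I.m : ℝ) * (2 : ℝ) ^ (-(k : ℝ)) ≤ I.n / (64 * k) := by
      rwa [le_div_iff₀ (by positivity)]
    have h2 : (I.n : ℝ) / (448 * L) ≤ I.n / (32 * k) :=
      div_le_div_of_nonneg_left hn (by positivity) (by linarith)
    -- Half of the saving `n / (16 * k)` pays for the sum over `A`; the other half remains.
    have h3 : (I.n : ℝ) / (16 * k) = I.n / (32 * k) + 2 * (I.n / (64 * k)) := by
      field_simp; ring
    linarith
  -- For an empty universe the estimate on `m * 2 ^ (-k)` may fail, but only one state exists.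
  · have hsub : R ⊆ {(0, ∅)} := by
      rintro ⟨j, X⟩ hx
      have hX : X = ∅ := Finset.card_eq_zero.1 (Nat.le_zero.1
        ((Finset.card_le_univ X).trans (by simp [h0])))
      have hj := (hR _ hx).le_n
      simp only at hj
      rw [Finset.mem_singleton, hX, show j = 0 by omega]
    have := Finset.card_le_card hsub
    rw [Finset.card_singleton] at this
    have hn0 : (I.n : ℝ) = 0 := by exact_mod_cast h0
    simpa [hn0] using this

end CoverInstance

/-! ### Encoding of states as machine words. -/

namespace CoverInstance

variable {I : CoverInstance} {d : Bool}

/-- The row of the adjacency matrix that belongs to `f`, as a bit vector. -/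
def row (I : CoverInstance) (f : Fin I.m) : ℕ := Nat.ofBits (I.edge f)

theorem row_lt (f : Fin I.m) : I.row f < 2 ^ I.n := Nat.ofBits_lt_two_pow _

theorem testBit_row (f : Fin I.m) (u : Fin I.n) : (I.row f).testBit u = I.edge f u := by
  simp [row]

/-- The subset of the universe that is stored in the low bits of `v`. -/
def lowSet (I : CoverInstance) (v : ℕ) : Finset (Fin I.n) :=
  Finset.univ.filter fun u => v.testBit u = true

theorem mem_lowSet {v : ℕ} {u : Fin I.n} : u ∈ I.lowSet v ↔ v.testBit u = true := by
  simp [lowSet]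

theorem mem_nbhd {f : Fin I.m} {u : Fin I.n} : u ∈ I.nbhd f ↔ I.edge f u = true := by
  simp [nbhd]

/-- Does `r` contain the least of the `n` low bits that is missing in `v`? -/
def HitsLeast (n v r : ℕ) : Prop :=
  ∃ u < n, v.testBit u = false ∧ r.testBit u = true ∧ ∀ u' < u, v.testBit u' = true

/-- May the word `v` be extended by the set `f`? -/
def CanStep (I : CoverInstance) (d : Bool) (v : ℕ) (f : Fin I.m) : Prop :=
  HitsLeast I.n v (I.row f) ∧ (d = true → v &&& I.row f = 0)

/-- The word `v` extended by the set `f`. -/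
def next (I : CoverInstance) (v : ℕ) (f : Fin I.m) : ℕ := (v ||| I.row f) + 2 ^ I.n

/-- The words reachable from `0`. A word holds a set in its `n` low bits and the number of
sets used so far in its high bits. -/
inductive WordReach (I : CoverInstance) (d : Bool) : ℕ → Prop
  | zero : WordReach I d 0
  | next {v : ℕ} {f : Fin I.m} : WordReach I d v → I.CanStep d v f → WordReach I d (I.next v f)

/-- Adding `2 ^ n` increments the counter in the high bits and leaves the low bits alone. -/
theorem lowSet_next (v : ℕ) (f : Fin I.m) : I.lowSet (I.next v f) = I.lowSet v ∪ I.nbhd f := by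
  ext u
  have h : (I.next v f).testBit u = (v ||| I.row f).testBit u := by
    have h1 := Nat.testBit_mod_two_pow (I.next v f) I.n u
    have h2 := Nat.testBit_mod_two_pow (v ||| I.row f) I.n u
    rw [next, Nat.add_mod_right] at h1
    simp only [u.isLt, decide_true, Bool.true_and] at h1 h2
    rw [next, ← h1, h2]
  rw [Finset.mem_union, mem_lowSet, h, mem_lowSet, mem_nbhd, Nat.testBit_or, testBit_row,
    Bool.or_eq_true]

theorem next_shiftRight (v : ℕ) (f : Fin I.m) : I.next v f >>> I.n = v >>> I.n + 1 := by
  have h : (v ||| I.row f) >>> I.n = v >>> I.n := by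
    rw [Nat.shiftRight_or_distrib, Nat.shiftRight_eq_div_pow (I.row f),
      Nat.div_eq_of_lt (row_lt f), Nat.or_zero]
  rw [Nat.shiftRight_eq_div_pow, next, Nat.add_div_right _ (by positivity),
    ← Nat.shiftRight_eq_div_pow, h]

theorem and_row_eq_zero_iff {v : ℕ} {f : Fin I.m} :
    v &&& I.row f = 0 ↔ Disjoint (I.lowSet v) (I.nbhd f) := by
  rw [Finset.disjoint_left]
  constructor
  · intro h u hu hf
    have := congrArg (fun x => x.testBit u) h
    simp only [Nat.testBit_and, testBit_row, mem_lowSet.1 hu, mem_nbhd.1 hf,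
      Nat.zero_testBit] at this
    exact absurd this (by simp)
  · intro h
    refine Nat.eq_of_testBit_eq fun i => ?_
    rw [Nat.testBit_and, Nat.zero_testBit]
    rcases lt_or_ge i I.n with hi | hi
    · by_contra hne
      rw [Bool.not_eq_false, Bool.and_eq_true] at hne
      exact h (mem_lowSet.2 hne.1 : (⟨i, hi⟩ : Fin I.n) ∈ _)
        (mem_nbhd.2 ((testBit_row f ⟨i, hi⟩).symm.trans hne.2))
    · rw [Nat.testBit_lt_two_pow ((row_lt f).trans_le (Nat.pow_le_pow_right (by norm_num) hi)),
        Bool.and_false]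

theorem canStep_iff {v : ℕ} {f : Fin I.m} :
    I.CanStep d v f ↔ (∃ u, u ∉ I.lowSet v ∧ (∀ u' < u, u' ∈ I.lowSet v) ∧ u ∈ I.nbhd f) ∧
      (d = true → Disjoint (I.lowSet v) (I.nbhd f)) := by
  rw [CanStep, and_row_eq_zero_iff]
  refine and_congr_left fun _ => ⟨?_, ?_⟩
  · rintro ⟨u, hu, h1, h2, h3⟩
    exact ⟨⟨u, hu⟩, by simp [mem_lowSet, h1], fun u' hu' => mem_lowSet.2 (h3 u' hu'),
      mem_nbhd.2 ((testBit_row f ⟨u, hu⟩).symm.trans h2)⟩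
  · rintro ⟨u, h1, h2, h3⟩
    refine ⟨u, u.isLt, by simpa [mem_lowSet] using h1, (testBit_row f u).trans (mem_nbhd.1 h3),
      fun u' hu' => mem_lowSet.1 (h2 ⟨u', hu'.trans u.isLt⟩ hu')⟩

theorem WordReach.reach {v : ℕ} (h : I.WordReach d v) : Reach I d (v >>> I.n) (I.lowSet v) := by
  induction h with
  | zero => simpa [lowSet] using Reach.nil
  | @next v f _ hs ih =>
    rw [lowSet_next, next_shiftRight]
    obtain ⟨⟨u, h1, h2, h3⟩, hd⟩ := canStep_iff.1 hs
    exact ih.cons u f h1 h2 h3 hd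

theorem Reach.exists_word {j : ℕ} {X : Finset (Fin I.n)} (h : Reach I d j X) :
    ∃ v, I.WordReach d v ∧ v >>> I.n = j ∧ I.lowSet v = X := by
  induction h with
  | nil => exact ⟨0, .zero, by simp, by simp [lowSet]⟩
  | @cons j X u f _ h1 h2 h3 hd ih =>
    obtain ⟨v, hv, rfl, rfl⟩ := ih
    exact ⟨I.next v f, hv.next (canStep_iff.2 ⟨⟨u, h1, h2, h3⟩, hd⟩), next_shiftRight v f,
      lowSet_next v f⟩

theorem eq_of_lowSet_eq {v v' : ℕ} (h1 : v >>> I.n = v' >>> I.n) (h2 : I.lowSet v = I.lowSet v') :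
    v = v' := by
  refine Nat.eq_of_testBit_eq fun i => ?_
  rcases lt_or_ge i I.n with hi | hi
  · have : (⟨i, hi⟩ : Fin I.n) ∈ I.lowSet v ↔ (⟨i, hi⟩ : Fin I.n) ∈ I.lowSet v' := by rw [h2]
    rw [mem_lowSet, mem_lowSet] at this
    exact Bool.eq_iff_iff.2 this
  · have := congrArg (fun x => x.testBit (i - I.n)) h1
    simpa only [Nat.testBit_shiftRight, Nat.add_sub_cancel' hi] using this

/-- The counter never exceeds `n < 2 ^ n`, so `n` bits suffice for it. -/
theorem WordReach.lt {v : ℕ} (h : I.WordReach d v) : v < 2 ^ (2 * I.n) := by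
  have h1 := h.reach.le_n.trans_lt (Nat.lt_two_pow_self (n := I.n))
  rw [Nat.shiftRight_eq_div_pow, Nat.div_lt_iff_lt_mul (by positivity)] at h1
  rwa [two_mul, pow_add]

/-- The machine tests only against zero, so equality with the full mask is expressed by cut-off
subtraction. -/
theorem sub_and_mask_eq_zero_iff {v : ℕ} :
    (2 ^ I.n - 1) - (v &&& (2 ^ I.n - 1)) = 0 ↔ I.lowSet v = Finset.univ := by
  rw [Nat.sub_eq_zero_iff_le, Nat.and_two_pow_sub_one_eq_mod]
  have hlt := Nat.mod_lt v (Nat.two_pow_pos I.n)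
  have h1 : 2 ^ I.n - 1 ≤ v % 2 ^ I.n ↔ v % 2 ^ I.n = 2 ^ I.n - 1 := by omega
  rw [h1]
  constructor
  · intro h
    refine Finset.eq_univ_of_forall fun u => mem_lowSet.2 ?_
    have := congrArg (fun x => x.testBit u) h
    simpa using this
  · intro h
    refine Nat.eq_of_testBit_eq fun i => ?_
    rw [Nat.testBit_mod_two_pow, Nat.testBit_two_pow_sub_one]
    by_cases hi : i < I.n
    · have := mem_lowSet.1 (h ▸ Finset.mem_univ (⟨i, hi⟩ : Fin I.n))
      simpa [hi] using this
    · simp [hi]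

theorem row_eq_zero_iff {f : Fin I.m} : I.row f = 0 ↔ I.nbhd f = ∅ := by
  constructor
  · intro h
    refine Finset.eq_empty_of_forall_notMem fun u hu => ?_
    have := (testBit_row f u).trans (mem_nbhd.1 hu)
    simp [h] at this
  · intro h
    have h1 : (2 ^ I.n - 1) &&& I.row f = 0 := and_row_eq_zero_iff.2 (by simp [h])
    rwa [Nat.and_comm, Nat.and_two_pow_sub_one_of_lt_two_pow (row_lt f)] at h1

/-- The word `v` is a witness. -/
def AcceptsWord (I : CoverInstance) (d : Bool) (v : ℕ) : Prop :=
  I.lowSet v = Finset.univ ∧ I.Accepts d (v >>> I.n)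

theorem exists_acceptsWord_iff :
    (∃ v, I.WordReach d v ∧ I.AcceptsWord d v) ↔
      ∃ j, Reach I d j Finset.univ ∧ I.Accepts d j := by
  constructor
  · rintro ⟨v, hv, hU, hA⟩
    exact ⟨_, hU ▸ hv.reach, hA⟩
  · rintro ⟨j, hj, hA⟩
    obtain ⟨v, hv, rfl, hU⟩ := hj.exists_word
    exact ⟨v, hv, hU, hA⟩

open Classical in
/-- The finite set of all reachable words. -/
noncomputable def reachable (I : CoverInstance) (d : Bool) : Finset ℕ :=
  (Finset.range (2 ^ (2 * I.n))).filter (I.WordReach d)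

theorem mem_reachable {v : ℕ} : v ∈ I.reachable d ↔ I.WordReach d v := by
  simp only [reachable, Finset.mem_filter, Finset.mem_range]
  exact ⟨fun h => h.2, fun h => ⟨h.lt, h⟩⟩

theorem lt_of_mem_reachable {v : ℕ} (h : v ∈ I.reachable d) : v < 2 ^ (2 * I.n) :=
  (mem_reachable.1 h).lt

theorem card_reachable_le_two_pow : (I.reachable d).card ≤ 2 ^ (2 * I.n) := by
  simpa using Finset.card_le_card
    (fun v hv => Finset.mem_range.2 (lt_of_mem_reachable hv) :
      I.reachable d ⊆ Finset.range (2 ^ (2 * I.n)))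

theorem card_reachable_le :
    ((I.reachable d).card : ℝ) ≤ (I.n + 1) * (2 : ℝ) ^ ((I.n : ℝ) -
      (I.n : ℝ) / (448 * Real.logb 2 (max ((I.m : ℝ) / (I.n : ℝ)) 2))) := by
  -- A word is determined by its counter and its set, so the bound on states applies to words.
  have hinj : Set.InjOn (fun v => (v >>> I.n, I.lowSet v)) (I.reachable d) := by
    intro v _ v' _ h
    exact eq_of_lowSet_eq (congrArg Prod.fst h) (congrArg Prod.snd h)
  rw [← Finset.card_image_of_injOn hinj]
  refine card_reach_le_two_pow (d := d) _ fun x hx => ?_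
  obtain ⟨v, hv, rfl⟩ := Finset.mem_image.1 hx
  exact (mem_reachable.1 hv).reach

theorem time_le (t : ℕ) (ht : t ≤ (I.reachable d).card * (I.m * (12 * I.n + 41) + 41) + 30) :
    (t : ℝ) ≤ fewSetsTime 448 ((Polynomial.X + 1) * (12 * Polynomial.X + 82) + 30) I := by
  have hR := card_reachable_le (I := I) (d := d)
  set L := Real.logb 2 (max ((I.m : ℝ) / (I.n : ℝ)) 2) with hL
  have hL1 : 1 ≤ L := by
    have h2 : (2 : ℝ) ≤ max ((I.m : ℝ) / (I.n : ℝ)) 2 := le_max_right _ _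
    rw [hL, Real.le_logb_iff_rpow_le (by norm_num) (by linarith), Real.rpow_one]; exact h2
  set E : ℝ := (2 : ℝ) ^ ((I.n : ℝ) - (I.n : ℝ) / (448 * L)) with hE
  have hE1 : 1 ≤ E := by
    refine Real.one_le_rpow (by norm_num) (sub_nonneg.2 ?_)
    exact div_le_self (by positivity) (by linarith)
  have hM1 : (1 : ℝ) ≤ max (I.m : ℝ) 1 := le_max_right _ _
  have hMm : (I.m : ℝ) ≤ max (I.m : ℝ) 1 := le_max_left _ _
  have hq : fewSetsTime 448 ((Polynomial.X + 1) * (12 * Polynomial.X + 82) + 30) I =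
      max (I.m : ℝ) 1 * ((I.n + 1) * (12 * I.n + 82) + 30) * E := by
    simp [fewSetsTime, hE, hL]
  rw [hq]
  set M := max (I.m : ℝ) 1
  have hn : (0 : ℝ) ≤ I.n := by positivity
  calc (t : ℝ) ≤ (I.reachable d).card * (I.m * (12 * I.n + 41) + 41) + 30 := by
        exact_mod_cast ht
    -- Costs that do not scale with `m` or with the number of states are absorbed using `M ≥ 1` and
    -- `E ≥ 1`.
    _ ≤ ((I.n + 1) * E) * (M * (12 * I.n + 41) + M * 41) + 30 * (M * E) := by
      gcongr
      · linarith
      · nlinarith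
    _ = _ := by ring

end CoverInstance

/-! ### Program logic for the word RAM. -/

namespace WordRAM

open CoverInstance

/-- The program `p` halts when started in `σ`, and `Q` holds of its running time and of the
final state. -/
def Halts (w : ℕ) (p : Prog) (σ : State) (Q : ℕ → State → Prop) : Prop :=
  ∃ t τ, Exec w p σ t τ ∧ Q t τ

section Rules

variable {w : ℕ} {σ : State} {Q Q' : ℕ → State → Prop} {p q : Prog}

theorem Halts.mono (h : Halts w p σ Q) (hQ : ∀ t τ, Q t τ → Q' t τ) : Halts w p σ Q' := by
  obtain ⟨t, τ, he, hq⟩ := h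
  exact ⟨t, τ, he, hQ t τ hq⟩

/-- This rule and those for the other loop-free constructs are equivalences, so that `simp` can
execute straight-line code symbolically. -/
theorem halts_const {d k : ℕ} : Halts w (.const d k) σ Q ↔ Q 1 (σ.setReg d (k % 2 ^ w)) := by
  refine ⟨?_, fun h => ⟨_, _, .const σ d k, h⟩⟩
  rintro ⟨t, τ, he, hq⟩
  cases he
  exact hq

theorem halts_op {o : Op} {d a b : ℕ} :
    Halts w (.op o d a b) σ Q ↔ Q 1 (σ.setReg d (o.eval w (σ.reg a) (σ.reg b))) := by
  refine ⟨?_, fun h => ⟨_, _, .op σ o d a b, h⟩⟩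
  rintro ⟨t, τ, he, hq⟩
  cases he
  exact hq

theorem halts_load {d a : ℕ} :
    Halts w (.load d a) σ Q ↔ Q 1 (σ.setReg d (σ.mem (σ.reg a))) := by
  refine ⟨?_, fun h => ⟨_, _, .load σ d a, h⟩⟩
  rintro ⟨t, τ, he, hq⟩
  cases he
  exact hq

theorem halts_store {a b : ℕ} :
    Halts w (.store a b) σ Q ↔ Q 1 (σ.setMem (σ.reg a) (σ.reg b)) := by
  refine ⟨?_, fun h => ⟨_, _, .store σ a b, h⟩⟩
  rintro ⟨t, τ, he, hq⟩
  cases he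
  exact hq

theorem halts_seq :
    Halts w (.seq p q) σ Q ↔ Halts w p σ fun t τ => Halts w q τ fun t' ρ => Q (t + t') ρ := by
  constructor
  · rintro ⟨t, τ, he, hq⟩
    cases he with
    | seq h1 h2 => exact ⟨_, _, h1, _, _, h2, hq⟩
  · rintro ⟨t, τ, h1, t', ρ, h2, hq⟩
    exact ⟨_, _, .seq h1 h2, hq⟩

theorem halts_branch {r : ℕ} :
    Halts w (.branch r p q) σ Q ↔
      if σ.reg r ≠ 0 then Halts w p σ fun t τ => Q (1 + t) τ
      else Halts w q σ fun t τ => Q (1 + t) τ := by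
  constructor
  · rintro ⟨t, τ, he, hq⟩
    cases he with
    | branch_pos h h1 => rw [if_pos h]; exact ⟨_, _, h1, hq⟩
    | branch_zero h h1 => rw [if_neg (not_not.2 h)]; exact ⟨_, _, h1, hq⟩
  · split_ifs with h
    · rintro ⟨t, τ, h1, hq⟩
      exact ⟨_, _, .branch_pos h h1, hq⟩
    · rintro ⟨t, τ, h1, hq⟩
      exact ⟨_, _, .branch_zero (not_not.1 h) h1, hq⟩

/-- A loop whose body decreases a measure terminates. -/
theorem halts_loop {r D : ℕ} (J : ℕ → State → Prop)
    -- The measure drops by exactly one per round, so its initial value bounds the number of rounds.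
    (hJ : ∀ k σ, J k σ → σ.reg r ≠ 0 →
      ∃ k', k = k' + 1 ∧ Halts w p σ fun t τ => t ≤ D ∧ J k' τ)
    (k : ℕ) (σ : State) (h : J k σ) :
    Halts w (.loop r p) σ fun t τ => t ≤ k * (D + 1) + 1 ∧ τ.reg r = 0 ∧ ∃ k', J k' τ := by
  induction k using Nat.strong_induction_on generalizing σ with
  | _ k ih =>
  by_cases h0 : σ.reg r = 0
  · exact ⟨_, _, .loop_zero h0, by omega, h0, k, h⟩
  · obtain ⟨k', rfl, t, τ, he, ht, hτ⟩ := hJ k σ h h0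
    obtain ⟨t', ρ, he', ht', hρ⟩ := ih k' (Nat.lt_succ_self _) τ hτ
    exact ⟨_, _, .loop_pos h0 he he', by rw [Nat.succ_mul]; omega, hρ⟩

theorem reg_setReg (σ : State) (d x i : ℕ) :
    (σ.setReg d x).reg i = if i = d then x else σ.reg i := by
  simp [State.setReg, Function.update_apply]

theorem mem_setReg (σ : State) (d x : ℕ) : (σ.setReg d x).mem = σ.mem := rfl

theorem reg_setMem (σ : State) (a x : ℕ) : (σ.setMem a x).reg = σ.reg := rfl

theorem mem_setMem (σ : State) (a x : ℕ) :
    (σ.setMem a x).mem = Function.update σ.mem a x := rfl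

end Rules

/-! ### Scanning a row of the matrix. -/

/-- Run the programs one after the other. -/
def Prog.block : List Prog → Prog
  | [] => .const 19 0
  | [p] => p
  | p :: ps => .seq p (Prog.block ps)

/-- Do nothing of importance. -/
def Prog.skip : Prog := .const 19 0

/-- Compute the row with base address `reg 12` in register `14`, and whether it contains the
least element missing in `reg 10` in register `15`. -/
def scanBody : Prog := .block
  [.op .sub 13 13 3, .op .add 17 12 13, .load 16 17, .op .shl 17 16 13, .op .lor 14 14 17,
   .op .shr 17 10 13, .op .land 17 17 3, .branch 17 .skip (.op .lor 15 16 16)]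

theorem toNat_mod_two_pow {w : ℕ} (h1 : 1 < 2 ^ w) (b : Bool) : b.toNat % 2 ^ w = b.toNat :=
  Nat.mod_eq_of_lt ((Bool.toNat_le b).trans_lt h1)

theorem halts_scanBody {w n v r c : ℕ} {σ : State} (hnw : n ≤ w) (h1 : 1 < 2 ^ w)
    (h3 : σ.reg 3 = 1) (hc : σ.reg 13 = c + 1) (hcn : c < n) (hv : σ.reg 10 = v)
    (hvw : v < 2 ^ w) (haddr : σ.reg 12 + n ≤ 2 ^ w) (hrow : r < 2 ^ n)
    (hmem : ∀ i < n, σ.mem (σ.reg 12 + i) = (r.testBit i).toNat)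
    (h14 : ∀ i, (σ.reg 14).testBit i = (decide (c + 1 ≤ i) && r.testBit i)) :
    Halts w scanBody σ fun t τ => t ≤ 11 ∧ (∀ i, i < 13 ∨ 19 < i → τ.reg i = σ.reg i) ∧
      τ.mem = σ.mem ∧ τ.reg 13 = c ∧
      (∀ i, (τ.reg 14).testBit i = (decide (c ≤ i) && r.testBit i)) ∧
      τ.reg 15 = if v.testBit c then σ.reg 15 else (r.testBit c).toNat := by
  have hcw : c < 2 ^ w := (hcn.trans_le hnw).trans Nat.lt_two_pow_self
  have e1 : (c + 1 - 1) % 2 ^ w = c := by simpa using Nat.mod_eq_of_lt hcw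
  have e2 : (σ.reg 12 + c) % 2 ^ w = σ.reg 12 + c := Nat.mod_eq_of_lt (by omega)
  have e3 : (v >>> c % 2 ^ w &&& 1) % 2 ^ w = (v.testBit c).toNat := by
    rw [Nat.mod_eq_of_lt ((Nat.shiftRight_le v c).trans_lt hvw), Nat.and_one_is_mod,
      Nat.shiftRight_eq_div_pow, ← Nat.toNat_testBit, toNat_mod_two_pow h1]
  have e4 : ∀ i, ((σ.reg 14 ||| (r.testBit c).toNat <<< c % 2 ^ w) % 2 ^ w).testBit i =
      (decide (c ≤ i) && r.testBit i) := by
    intro i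
    simp only [Nat.testBit_mod_two_pow, Nat.testBit_or, h14, Nat.testBit_shiftLeft]
    by_cases hi : i < w
    · rcases lt_trichotomy i c with h | rfl | h
      · simp [hi, not_le.2 h, not_le.2 (h.trans (Nat.lt_succ_self c))]
      · cases h : r.testBit i <;> simp [hi]
      · have : (r.testBit c).toNat.testBit (i - c) = false :=
          Nat.testBit_lt_two_pow ((Bool.toNat_le _).trans_lt
            (Nat.one_lt_two_pow (by omega)))
        simp [hi, h.le, this, Nat.succ_le_of_lt h]
    · rw [Nat.testBit_lt_two_pow (x := r) (i := i) (hrow.trans_le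
        (Nat.pow_le_pow_right (by norm_num) (by omega)))]
      simp [hi]
  simp only [scanBody, Prog.block, Prog.skip, halts_seq, halts_op, halts_load, halts_branch,
    halts_const, Op.eval, reg_setReg, mem_setReg, Nat.reduceEqDiff, if_true, if_false, h3, hc, hv,
    e1, e2, hmem c hcn, e3, e4, Nat.or_self, toNat_mod_two_pow h1]
  have hfr : ∀ i, i < 13 ∨ 19 < i → i ≠ 13 ∧ i ≠ 14 ∧ i ≠ 15 ∧ i ≠ 16 ∧ i ≠ 17 ∧ i ≠ 19 := by
    omega
  cases v.testBit c
  all_goals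
    simp only [Bool.toNat_true, Bool.toNat_false, ne_eq, one_ne_zero, not_false_eq_true,
      not_true_eq_false, if_true, if_false, implies_true, and_self, and_true, true_and,
      Bool.false_eq_true, Nat.reduceAdd, Nat.reduceLeDiff]
    intro i hi
    obtain ⟨i13, i14, i15, i16, i17, i19⟩ := hfr i hi
    simp only [i13, i14, i15, i16, i17, i19, if_false]

theorem halts_scan {w n v r : ℕ} {σ : State} (hnw : n ≤ w) (h1 : 1 < 2 ^ w)
    (h3 : σ.reg 3 = 1) (h13 : σ.reg 13 = n) (hv : σ.reg 10 = v)
    (hvw : v < 2 ^ w) (haddr : σ.reg 12 + n ≤ 2 ^ w) (hrow : r < 2 ^ n)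
    (hmem : ∀ i < n, σ.mem (σ.reg 12 + i) = (r.testBit i).toNat)
    (h14 : σ.reg 14 = 0) (h15 : σ.reg 15 = 0) :
    Halts w (.loop 13 scanBody) σ fun t τ => t ≤ n * 12 + 1 ∧
      (∀ i, i < 13 ∨ 19 < i → τ.reg i = σ.reg i) ∧ τ.mem = σ.mem ∧ τ.reg 14 = r ∧
      (τ.reg 15 ≠ 0 ↔ HitsLeast n v r) := by
  -- The scan runs downwards and overwrites register `15` at every bit missing in `v`, so the value
  -- that survives belongs to the least missing bit. The invariant states this for the positions
  -- from `c` on.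
  let J : ℕ → State → Prop := fun c τ => τ.reg 13 = c ∧ c ≤ n ∧
    (∀ i, i < 13 ∨ 19 < i → τ.reg i = σ.reg i) ∧ τ.mem = σ.mem ∧
    (∀ i, (τ.reg 14).testBit i = (decide (c ≤ i) && r.testBit i)) ∧
    (τ.reg 15 ≠ 0 ↔ ∃ u < n, c ≤ u ∧ v.testBit u = false ∧ r.testBit u = true ∧
      ∀ u', c ≤ u' → u' < u → v.testBit u' = true)
  have hbig : ∀ i, n ≤ i → r.testBit i = false := fun i hi =>
    Nat.testBit_lt_two_pow (hrow.trans_le (Nat.pow_le_pow_right (by norm_num) hi))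
  refine (halts_loop (D := 11) J ?_ n σ ?_).mono ?_
  · rintro k τ ⟨k13, kn, kfr, kmem, k14, k15⟩ h0
    obtain ⟨c, rfl⟩ : ∃ c, k = c + 1 := Nat.exists_eq_succ_of_ne_zero (k13 ▸ h0)
    have f12 : τ.reg 12 = σ.reg 12 := kfr 12 (by norm_num)
    refine ⟨c, rfl, (halts_scanBody hnw h1 ((kfr 3 (by norm_num)).trans h3) k13 kn
      ((kfr 10 (by norm_num)).trans hv) hvw (by rwa [f12]) hrow
      (by rw [f12, kmem]; exact hmem) k14).mono ?_⟩
    rintro t ρ ⟨ht, hfr, hm, h13', h14', h15'⟩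
    refine ⟨ht, h13', by omega, fun i hi => (hfr i hi).trans (kfr i hi), hm.trans kmem, h14', ?_⟩
    rw [h15']
    cases hx : v.testBit c
    · simp only [Bool.false_eq_true, if_false]
      constructor
      · intro h
        refine ⟨c, kn, le_rfl, hx, by simpa using h, fun u' h1 h2 => by omega⟩
      · rintro ⟨u, hun, hcu, h2, h3, h4⟩
        rcases hcu.eq_or_lt with rfl | hlt
        · simp [h3]
        · rw [h4 c le_rfl hlt] at hx; exact absurd hx (by simp)
    · simp only [if_true]
      rw [k15]
      constructor
      · rintro ⟨u, hun, hcu, h2, h3, h4⟩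
        refine ⟨u, hun, by omega, h2, h3, fun u' hu' hlt => ?_⟩
        rcases hu'.eq_or_lt with rfl | h
        exacts [hx, h4 u' h hlt]
      · rintro ⟨u, hun, hcu, h2, h3, h4⟩
        refine ⟨u, hun, ?_, h2, h3, fun u' hu' hlt => h4 u' (by omega) hlt⟩
        rcases hcu.eq_or_lt with rfl | h
        · rw [h2] at hx; exact absurd hx (by simp)
        · exact h
  · refine ⟨h13, le_rfl, fun _ _ => rfl, rfl, fun i => ?_, ?_⟩
    · rw [h14, Nat.zero_testBit]
      by_cases hi : n ≤ i
      · rw [hbig i hi, Bool.and_false]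
      · simp [hi]
    · simp only [h15, ne_eq, not_true_eq_false, false_iff]
      rintro ⟨u, h1, h2, -⟩
      omega
  · rintro t τ ⟨ht, h0, k, k13, -, kfr, kmem, k14, k15⟩
    obtain rfl : k = 0 := k13.symm.trans h0
    exact ⟨ht, kfr, kmem, Nat.eq_of_testBit_eq fun i => by simpa using k14 i, by
      simpa [HitsLeast] using k15⟩

end WordRAM

/-! ### The search invariant and the expansion of a word by one set. -/

namespace WordRAM

open CoverInstance

variable {I : CoverInstance} {d : Bool} {w : ℕ}

/-- The word length suffices for all numbers that occur. -/
structure Wide (I : CoverInstance) (w : ℕ) : Prop where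
  space : I.m * I.n + 2 * 2 ^ (2 * I.n) ≤ 2 ^ w
  sum : I.m + I.n + I.s + 2 ≤ 2 ^ w
  le : I.n ≤ w

/-- The registers that hold constants. -/
structure Consts (I : CoverInstance) (d : Bool) (σ : State) : Prop where
  r0 : σ.reg 0 = I.n
  r1 : σ.reg 1 = I.m
  r2 : σ.reg 2 = I.s
  r3 : σ.reg 3 = 1
  r4 : σ.reg 4 = I.m * I.n
  r5 : σ.reg 5 = I.m * I.n + 2 ^ (2 * I.n)
  r6 : σ.reg 6 = 2 ^ I.n
  r7 : σ.reg 7 = 2 ^ I.n - 1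
  r21 : σ.reg 21 = d.toNat

theorem Consts.frame {σ τ : State} (h : Consts I d σ)
    (hτ : ∀ i, i ≤ 7 ∨ i = 21 → τ.reg i = σ.reg i) : Consts I d τ where
  r0 := (hτ 0 (by norm_num)).trans h.r0
  r1 := (hτ 1 (by norm_num)).trans h.r1
  r2 := (hτ 2 (by norm_num)).trans h.r2
  r3 := (hτ 3 (by norm_num)).trans h.r3
  r4 := (hτ 4 (by norm_num)).trans h.r4
  r5 := (hτ 5 (by norm_num)).trans h.r5
  r6 := (hτ 6 (by norm_num)).trans h.r6
  r7 := (hτ 7 (by norm_num)).trans h.r7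
  r21 := (hτ 21 (by norm_num)).trans h.r21

/-- The invariant of the search: `V` is the set of the words found so far, the stack of height
`sp` holds those that are still to be processed, and all others, except those in `ex`, are
processed. -/
structure Search (I : CoverInstance) (d : Bool) (mem : ℕ → ℕ) (sp ans : ℕ) (V : Finset ℕ)
    (ex : ℕ → Prop) : Prop where
  matrix : ∀ (f : Fin I.m) (u : Fin I.n), mem (f * I.n + u) = (I.edge f u).toNat
  table : ∀ v < 2 ^ (2 * I.n), mem (I.m * I.n + v) ≠ 0 ↔ v ∈ V
  stack : ∀ i < sp, mem (I.m * I.n + 2 ^ (2 * I.n) + i) ∈ V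
  processed : ∀ v ∈ V, (∃ i < sp, mem (I.m * I.n + 2 ^ (2 * I.n) + i) = v) ∨ ex v ∨
    ((∀ f, I.CanStep d v f → I.next v f ∈ V) ∧ (I.AcceptsWord d v → ans = 1))
  subset : V ⊆ I.reachable d
  zero_mem : 0 ∈ V
  height_le : sp ≤ V.card
  sound : ans = 0 ∨ ans = 1 ∧ ∃ v, I.WordReach d v ∧ I.AcceptsWord d v

/-- Matrix, table and stack occupy consecutive disjoint memory regions, so marking `v` and putting
it on the stack disturbs nothing else. -/
theorem Search.push {mem : ℕ → ℕ} {sp ans v : ℕ} {V : Finset ℕ} {ex : ℕ → Prop}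
    (h : Search I d mem sp ans V ex) (hv : v ∈ I.reachable d) (hvV : v ∉ V) :
    Search I d (Function.update (Function.update mem (I.m * I.n + v) 1)
      (I.m * I.n + 2 ^ (2 * I.n) + sp) v) (sp + 1) ans (insert v V) ex := by
  have hv2 := lt_of_mem_reachable hv
  have hsub : insert v V ⊆ I.reachable d := Finset.insert_subset hv h.subset
  have hcard := Finset.card_insert_of_notMem hvV
  have hstk : ∀ i, i < sp → Function.update (Function.update mem (I.m * I.n + v) 1)
      (I.m * I.n + 2 ^ (2 * I.n) + sp) v (I.m * I.n + 2 ^ (2 * I.n) + i) =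
      mem (I.m * I.n + 2 ^ (2 * I.n) + i) := fun i hi => by
    rw [Function.update_of_ne (by omega), Function.update_of_ne (by omega)]
  refine ⟨fun f u => ?_, fun v' hv' => ?_, fun i hi => ?_, fun v' hv' => ?_, hsub,
    Finset.mem_insert_of_mem h.zero_mem, by have := h.height_le; omega, h.sound⟩
  · have : f.val * I.n + u.val < I.m * I.n := by
      calc f.val * I.n + u.val < (f.val + 1) * I.n := by rw [Nat.succ_mul]; omega
        _ ≤ I.m * I.n := Nat.mul_le_mul_right _ f.isLt
    rw [Function.update_of_ne (by omega), Function.update_of_ne (by omega)]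
    exact h.matrix f u
  · rw [Function.update_of_ne (by omega)]
    rcases eq_or_ne v' v with rfl | hne
    · simp
    · rw [Function.update_of_ne (by omega), h.table v' hv', Finset.mem_insert]
      simp [hne]
  · rcases Nat.lt_succ_iff_lt_or_eq.1 hi with hi | rfl
    · rw [hstk i hi]
      exact Finset.mem_insert_of_mem (h.stack i hi)
    · simp
  · rcases Finset.mem_insert.1 hv' with rfl | hv'
    · exact Or.inl ⟨sp, Nat.lt_succ_self _, by simp⟩
    · rcases h.processed v' hv' with ⟨i, hi, h1⟩ | h1 | ⟨h1, h2⟩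
      · exact Or.inl ⟨i, hi.trans (Nat.lt_succ_self _), (hstk i hi).trans h1⟩
      · exact Or.inr (Or.inl h1)
      · exact Or.inr (Or.inr ⟨fun f hf => Finset.mem_insert_of_mem (h1 f hf), h2⟩)

/-- Push the successor of `reg 10` by the row in `reg 14`, unless it is marked. -/
def pushNew : Prog := .block
  [.op .lor 17 10 14, .op .add 17 17 6, .op .add 18 4 17, .load 19 18,
   .branch 19 .skip (.block [.store 18 3, .op .add 18 5 8, .store 18 17, .op .add 8 8 3])]

theorem halts_pushNew {σ : State} {v ans : ℕ} {f : Fin I.m} {V : Finset ℕ} {ex : ℕ → Prop}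
    (hw : Wide I w) (hc : Consts I d σ) (hv : v ∈ I.reachable d) (h10 : σ.reg 10 = v)
    (h14 : σ.reg 14 = I.row f) (hs : I.CanStep d v f)
    (h : Search I d σ.mem (σ.reg 8) ans V ex) :
    Halts w pushNew σ fun t τ => t ≤ 9 ∧ (∀ i, i ≤ 7 ∨ 9 ≤ i ∧ i ≤ 16 ∨ 20 ≤ i →
      τ.reg i = σ.reg i) ∧ ∃ V', V ⊆ V' ∧ I.next v f ∈ V' ∧
        Search I d τ.mem (τ.reg 8) ans V' ex ∧ τ.reg 8 + V.card = σ.reg 8 + V'.card := by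
  have hR : I.next v f ∈ I.reachable d := mem_reachable.2 ((mem_reachable.1 hv).next hs)
  have hlt := lt_of_mem_reachable hR
  have hsp := hw.space
  have hdef : I.next v f = (v ||| I.row f) + 2 ^ I.n := rfl
  have hpos := Nat.two_pow_pos I.n
  have hRc := card_reachable_le_two_pow (I := I) (d := d)
  have e1 : (v ||| I.row f) % 2 ^ w = v ||| I.row f := Nat.mod_eq_of_lt (by omega)
  have e2 : ((v ||| I.row f) + 2 ^ I.n) % 2 ^ w = I.next v f := Nat.mod_eq_of_lt (by omega)
  have e3 : (I.m * I.n + I.next v f) % 2 ^ w = I.m * I.n + I.next v f :=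
    Nat.mod_eq_of_lt (by omega)
  have hfr : ∀ i, i ≤ 7 ∨ 9 ≤ i ∧ i ≤ 16 ∨ 20 ≤ i → i ≠ 8 ∧ i ≠ 17 ∧ i ≠ 18 ∧ i ≠ 19 := by omega
  simp only [pushNew, Prog.block, Prog.skip, halts_seq, halts_op, halts_load, halts_branch,
    halts_store, halts_const, Op.eval, reg_setReg, mem_setReg, reg_setMem, mem_setMem,
    Nat.reduceEqDiff, if_true, if_false, hc.r3, hc.r4, hc.r5, hc.r6, h10, h14, e1, e2, e3,
    h.table _ hlt, Nat.reduceAdd]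
  split_ifs with hin
  · refine ⟨by norm_num, fun i hi => ?_, V, le_rfl, hin, h, rfl⟩
    obtain ⟨-, i17, i18, i19⟩ := hfr i hi
    simp only [i17, i18, i19, if_false]
  -- The stack holds at most as many words as have been found, and the new word is not yet among
  -- them; hence the stack address does not overflow.
  · have hcard : σ.reg 8 < 2 ^ (2 * I.n) := by
      have h1 := Finset.card_le_card (Finset.insert_subset hR h.subset)
      rw [Finset.card_insert_of_notMem hin] at h1
      have := h.height_le
      omega
    have e4 : (I.m * I.n + 2 ^ (2 * I.n) + σ.reg 8) % 2 ^ w = I.m * I.n + 2 ^ (2 * I.n) + σ.reg 8 :=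
      Nat.mod_eq_of_lt (by omega)
    have e5 : (σ.reg 8 + 1) % 2 ^ w = σ.reg 8 + 1 := Nat.mod_eq_of_lt (by omega)
    rw [e4, e5]
    refine ⟨by norm_num, fun i hi => ?_, _, Finset.subset_insert _ _,
      Finset.mem_insert_self _ _, h.push hR hin, ?_⟩
    · obtain ⟨i8, i17, i18, i19⟩ := hfr i hi
      simp only [i8, i17, i18, i19, if_false]
    · rw [Finset.card_insert_of_notMem hin]; omega

/-- Count the empty rows in `reg 20`, and check in `reg 15` for disjointness if required. -/
def classify : Prog := .block
  [.branch 14 .skip (.op .add 20 20 3), .op .land 17 10 14, .op .mul 17 17 21,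
   .branch 17 (.const 15 0) .skip]

theorem halts_classify {σ : State} {v e r : ℕ} (h3 : σ.reg 3 = 1) (h21 : σ.reg 21 = d.toNat)
    (hv : v < 2 ^ w) (he : e + 1 < 2 ^ w) (h10 : σ.reg 10 = v) (h14 : σ.reg 14 = r)
    (h20 : σ.reg 20 = e) :
    Halts w classify σ fun t τ => t ≤ 6 ∧ τ.mem = σ.mem ∧
      (∀ i, i ≤ 14 ∨ i = 21 → τ.reg i = σ.reg i) ∧
      τ.reg 20 = e + (if r = 0 then 1 else 0) ∧
      (τ.reg 15 ≠ 0 ↔ σ.reg 15 ≠ 0 ∧ (d = true → v &&& r = 0)) := by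
  have e4 : (e + 1) % 2 ^ w = e + 1 := Nat.mod_eq_of_lt he
  -- Multiplication by the flag `d` makes the disjointness test vacuous for covers.
  have e5 : ((v &&& r) % 2 ^ w * d.toNat) % 2 ^ w = (v &&& r) * d.toNat := by
    have : v &&& r < 2 ^ w := Nat.and_le_left.trans_lt hv
    cases d <;> simp [Nat.mod_eq_of_lt this]
  have hfr : ∀ i, i ≤ 14 ∨ i = 21 → i ≠ 15 ∧ i ≠ 17 ∧ i ≠ 19 ∧ i ≠ 20 := by omega
  simp only [classify, Prog.block, Prog.skip, halts_seq, halts_op, halts_const, halts_branch,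
    Op.eval, reg_setReg, mem_setReg, Nat.reduceEqDiff, if_true, if_false, h3, h10, h14, h20, h21,
    e4, e5, Nat.zero_mod, ← Nat.add_assoc, Nat.reduceAdd]
  split_ifs with h1 h2 h2
  all_goals
    refine ⟨by norm_num, trivial, fun i hi => ?_, ?_, ?_⟩
    · obtain ⟨i1, i2, i3, i4⟩ := hfr i hi
      simp only [i1, i2, i3, i4, if_false]
    · first | rfl | contradiction
    · cases d <;> simp_all

/-- Process the set `f` with `f + 1` in `reg 11`, for the word in `reg 10`. -/
def visitBody : Prog := .block
  [.op .sub 11 11 3, .op .mul 12 11 0, .const 14 0, .const 15 0, .op .lor 13 0 0,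
   .loop 13 scanBody, classify, .branch 15 pushNew .skip]

theorem halts_visitBody {σ : State} {v ans e : ℕ} {f : Fin I.m} {V : Finset ℕ} {ex : ℕ → Prop}
    (hw : Wide I w) (hc : Consts I d σ) (hv : v ∈ I.reachable d) (h10 : σ.reg 10 = v)
    (h11 : σ.reg 11 = f + 1) (h20 : σ.reg 20 = e) (he : e < I.m)
    (h : Search I d σ.mem (σ.reg 8) ans V ex) :
    Halts w visitBody σ fun t τ => t ≤ 12 * I.n + 40 ∧
      (∀ i, i ≤ 7 ∨ i = 9 ∨ i = 10 ∨ i = 21 → τ.reg i = σ.reg i) ∧ τ.reg 11 = f ∧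
      τ.reg 20 = e + (if I.row f = 0 then 1 else 0) ∧
      ∃ V', V ⊆ V' ∧ (I.CanStep d v f → I.next v f ∈ V') ∧
        Search I d τ.mem (τ.reg 8) ans V' ex ∧ τ.reg 8 + V.card = σ.reg 8 + V'.card := by
  have hsum := hw.sum
  have hsp := hw.space
  have hv2 := lt_of_mem_reachable hv
  have hf := f.isLt
  have hfn : f.val * I.n + I.n ≤ I.m * I.n := by
    rw [← Nat.succ_mul]; exact Nat.mul_le_mul_right _ hf
  have hpos : 0 < 2 ^ (2 * I.n) := by positivity
  have e1 : (f.val + 1 - 1) % 2 ^ w = f := by simpa using Nat.mod_eq_of_lt (by omega)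
  have e2 : (f.val * I.n) % 2 ^ w = f * I.n := Nat.mod_eq_of_lt (by omega)
  have e3 : I.n % 2 ^ w = I.n := Nat.mod_eq_of_lt (by omega)
  simp only [visitBody, Prog.block, halts_seq, halts_op, halts_const, Op.eval, reg_setReg,
    Nat.reduceEqDiff, if_true, if_false, hc.r0, hc.r3, h11, e1, e2, e3, Nat.zero_mod,
    Nat.or_self]
  refine (halts_scan (n := I.n) (v := v) (r := I.row f) hw.le (by omega) ?_ ?_ ?_ (by omega) ?_
    (row_lt f) ?_ ?_ ?_).mono ?_
  · simpa [reg_setReg] using hc.r3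
  · simp [reg_setReg]
  · simpa [reg_setReg] using h10
  · simp only [reg_setReg, Nat.reduceEqDiff, if_true, if_false]; omega
  · intro i hi
    simp only [reg_setReg, mem_setReg, Nat.reduceEqDiff, if_true, if_false]
    rw [h.matrix f ⟨i, hi⟩, ← testBit_row]
  · simp [reg_setReg]
  · simp [reg_setReg]
  rintro t τ ⟨ht, hfr, hm, h14, h15⟩
  have g : ∀ i, i ≤ 10 ∨ 20 ≤ i → τ.reg i = σ.reg i := by
    intro i hi
    rw [hfr i (by omega)]
    have : i ≠ 11 ∧ i ≠ 12 ∧ i ≠ 13 ∧ i ≠ 14 ∧ i ≠ 15 := by omega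
    obtain ⟨i1, i2, i3, i4, i5⟩ := this
    simp only [reg_setReg, i1, i2, i3, i4, i5, if_false]
  have g11 : τ.reg 11 = f := by
    rw [hfr 11 (by norm_num)]; simp [reg_setReg]
  have gc : Consts I d τ := hc.frame fun i hi => g i (by omega)
  have g10 : τ.reg 10 = v := (g 10 (by norm_num)).trans h10
  refine (halts_classify gc.r3 gc.r21 (by omega) (by omega) g10 h14
    ((g 20 (by norm_num)).trans h20)).mono ?_
  rintro t' ρ ⟨ht', hm', hfr', h20', h15'⟩
  rw [h15] at h15'
  have s8 : ρ.reg 8 = σ.reg 8 := (hfr' 8 (by norm_num)).trans (g 8 (by norm_num))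
  have hS : Search I d ρ.mem (ρ.reg 8) ans V ex := by rw [s8, hm', hm]; exact h
  rw [halts_branch]
  by_cases h1 : ρ.reg 15 ≠ 0
  · rw [if_pos h1]
    refine (halts_pushNew hw (gc.frame fun i hi => hfr' i (by omega)) hv
      ((hfr' 10 (by norm_num)).trans g10) ((hfr' 14 (by norm_num)).trans h14) (h15'.1 h1) hS).mono ?_
    rintro t'' ρ' ⟨ht'', hfr'', V', h2, h3, h4, h5⟩
    refine ⟨by omega, fun i hi => ?_, ?_, ?_, V', h2, fun _ => h3, h4, by rwa [s8] at h5⟩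
    · rw [hfr'' i (by omega), hfr' i (by omega), g i (by omega)]
    · rw [hfr'' 11 (by norm_num), hfr' 11 (by norm_num), g11]
    · rw [hfr'' 20 (by norm_num), h20']
  · rw [if_neg h1]
    simp only [Prog.skip, halts_const, reg_setReg, mem_setReg, Nat.reduceEqDiff, if_false]
    refine ⟨by omega, fun i hi => ?_, ?_, h20', V, le_rfl, fun h2 => absurd (h15'.2 h2) h1, hS,
      by rw [s8]⟩
    · rw [if_neg (by omega), hfr' i (by omega), g i (by omega)]
    · rw [hfr' 11 (by norm_num), g11]

end WordRAM

/-! ### Expanding a word by the whole family, and the main loop. -/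

namespace WordRAM

open CoverInstance

variable {I : CoverInstance} {d : Bool} {w : ℕ}

/-- Used once a word has been fully expanded and tested: it stops being an exception, and the answer
may change from `0` to `1`. -/
theorem Search.mono {mem : ℕ → ℕ} {sp ans : ℕ} {V : Finset ℕ} {ex ex' : ℕ → Prop}
    (h : Search I d mem sp ans V ex) {ans' : ℕ}
    (hs : ans' = 0 ∨ ans' = 1 ∧ ∃ v, I.WordReach d v ∧ I.AcceptsWord d v)
    (ha : ans = 1 → ans' = 1)
    (hex : ∀ v ∈ V, ex v → ex' v ∨
      ((∀ f, I.CanStep d v f → I.next v f ∈ V) ∧ (I.AcceptsWord d v → ans' = 1))) :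
    Search I d mem sp ans' V ex' where
  matrix := h.matrix
  table := h.table
  stack := h.stack
  processed := fun v hv => by
    rcases h.processed v hv with h1 | h1 | ⟨h1, h2⟩
    · exact Or.inl h1
    · exact Or.inr (hex v hv h1)
    · exact Or.inr (Or.inr ⟨h1, fun h3 => ha (h2 h3)⟩)
  subset := h.subset
  zero_mem := h.zero_mem
  height_le := h.height_le
  sound := hs

/-- The popped word is no longer on the stack and not yet processed, so it becomes the exception. -/
theorem Search.pop {mem : ℕ → ℕ} {sp ans : ℕ} {V : Finset ℕ}
    (h : Search I d mem (sp + 1) ans V fun _ => False) :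
    Search I d mem sp ans V fun v => v = mem (I.m * I.n + 2 ^ (2 * I.n) + sp) where
  matrix := h.matrix
  table := h.table
  stack := fun i hi => h.stack i (hi.trans (Nat.lt_succ_self _))
  processed := fun v hv => by
    rcases h.processed v hv with ⟨i, hi, h1⟩ | h1 | h1
    · rcases Nat.lt_succ_iff_lt_or_eq.1 hi with hi | rfl
      · exact Or.inl ⟨i, hi, h1⟩
      · exact Or.inr (Or.inl h1.symm)
    · exact h1.elim
    · exact Or.inr (Or.inr h1)
  subset := h.subset
  zero_mem := h.zero_mem
  height_le := (Nat.le_succ _).trans h.height_le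
  sound := h.sound

/-- When the stack is empty, the search is complete. -/
theorem Search.answer {mem : ℕ → ℕ} {ans : ℕ} {V : Finset ℕ}
    (h : Search I d mem 0 ans V fun _ => False) :
    ((∃ v, I.WordReach d v ∧ I.AcceptsWord d v) → ans = 1) ∧
      (¬ (∃ v, I.WordReach d v ∧ I.AcceptsWord d v) → ans = 0) := by
  have hp : ∀ v ∈ V, (∀ f, I.CanStep d v f → I.next v f ∈ V) ∧ (I.AcceptsWord d v → ans = 1) := by
    intro v hv
    rcases h.processed v hv with ⟨i, hi, -⟩ | h1 | h1
    exacts [absurd hi (Nat.not_lt_zero _), h1.elim, h1]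
  -- `V` contains `0` and is closed under steps.
  have hall : ∀ v, I.WordReach d v → v ∈ V := by
    intro v hv
    induction hv with
    | zero => exact h.zero_mem
    | next _ hs ih => exact (hp _ ih).1 _ hs
  refine ⟨fun ⟨v, hv, ha⟩ => (hp v (hall v hv)).2 ha, fun hn => ?_⟩
  exact h.sound.resolve_right fun h1 => hn h1.2

/-- The number of empty sets of index at least `c`. -/
def emptyCountFrom (I : CoverInstance) (c : ℕ) : ℕ :=
  (Finset.univ.filter fun f : Fin I.m => c ≤ f.val ∧ I.row f = 0).card

theorem emptyCountFrom_zero : emptyCountFrom I 0 = I.emptyCount := by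
  simp [emptyCountFrom, emptyCount, row_eq_zero_iff]

theorem emptyCountFrom_eq_zero : emptyCountFrom I I.m = 0 := by
  rw [emptyCountFrom, Finset.card_eq_zero, Finset.filter_eq_empty_iff]
  exact fun f _ h => absurd f.isLt (not_lt.2 h.1)

theorem emptyCountFrom_val (f : Fin I.m) :
    emptyCountFrom I f = emptyCountFrom I (f + 1) + if I.row f = 0 then 1 else 0 := by
  have h : (Finset.univ.filter fun g : Fin I.m => f.val ≤ g.val ∧ I.row g = 0) =
      (Finset.univ.filter fun g : Fin I.m => f.val + 1 ≤ g.val ∧ I.row g = 0) ∪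
        (if I.row f = 0 then {f} else ∅) := by
    ext g
    by_cases hg : g = f
    · subst hg; split_ifs <;> simp [*]
    · have : f.val ≤ g.val ↔ f.val + 1 ≤ g.val := by
        have : g.val ≠ f.val := fun h => hg (Fin.ext h)
        omega
      rw [Finset.mem_union, Finset.mem_filter, Finset.mem_filter, this]
      split_ifs <;> simp [hg]
  rw [emptyCountFrom, h, Finset.card_union_of_disjoint, emptyCountFrom]
  · split_ifs <;> simp
  · split_ifs <;> simp

/-- The index `f` itself is not counted; the strict bound lets the counter be incremented without
overflow. -/
theorem emptyCountFrom_lt (f : Fin I.m) : emptyCountFrom I (f + 1) < I.m := by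
  have h : (Finset.univ.filter fun g : Fin I.m => f.val + 1 ≤ g.val ∧ I.row g = 0) ⊂
      Finset.univ := by
    refine Finset.ssubset_iff_subset_ne.2 ⟨Finset.subset_univ _, fun h => ?_⟩
    have := (Finset.mem_filter.1 (h ▸ Finset.mem_univ f)).2.1
    omega
  simpa [emptyCountFrom] using Finset.card_lt_card h

theorem halts_visit {σ : State} {v ans : ℕ} {V : Finset ℕ} {ex : ℕ → Prop}
    (hw : Wide I w) (hc : Consts I d σ) (hv : v ∈ I.reachable d) (h10 : σ.reg 10 = v)
    (h11 : σ.reg 11 = I.m) (h20 : σ.reg 20 = 0) (h : Search I d σ.mem (σ.reg 8) ans V ex) :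
    Halts w (.loop 11 visitBody) σ fun t τ => t ≤ I.m * (12 * I.n + 41) + 1 ∧
      (∀ i, i ≤ 7 ∨ i = 9 ∨ i = 10 ∨ i = 21 → τ.reg i = σ.reg i) ∧
      τ.reg 20 = I.emptyCount ∧
      ∃ V', V ⊆ V' ∧ (∀ f, I.CanStep d v f → I.next v f ∈ V') ∧
        Search I d τ.mem (τ.reg 8) ans V' ex ∧ τ.reg 8 + V.card = σ.reg 8 + V'.card := by
  -- The indices are visited downwards, so the sets done so far are those of index at least `c`.
  -- Every push raises the stack height and the size of `V` by the same amount, whence the last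
  -- equation.
  let J : ℕ → State → Prop := fun c τ => τ.reg 11 = c ∧ c ≤ I.m ∧
    (∀ i, i ≤ 7 ∨ i = 9 ∨ i = 10 ∨ i = 21 → τ.reg i = σ.reg i) ∧
    τ.reg 20 = emptyCountFrom I c ∧
    ∃ V', V ⊆ V' ∧ (∀ f : Fin I.m, c ≤ f → I.CanStep d v f → I.next v f ∈ V') ∧
      Search I d τ.mem (τ.reg 8) ans V' ex ∧ τ.reg 8 + V.card = σ.reg 8 + V'.card
  refine (halts_loop (D := 12 * I.n + 40) J ?_ I.m σ ?_).mono ?_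
  · rintro k τ ⟨k11, km, kfr, k20, V', hV, hst, hS, hcard⟩ h0
    obtain ⟨c, rfl⟩ : ∃ c, k = c + 1 := Nat.exists_eq_succ_of_ne_zero (k11 ▸ h0)
    refine ⟨c, rfl, (halts_visitBody (f := ⟨c, km⟩) hw (hc.frame fun i hi => kfr i (by omega)) hv
      ((kfr 10 (by norm_num)).trans h10) k11 k20 (emptyCountFrom_lt ⟨c, km⟩) hS).mono ?_⟩
    rintro t ρ ⟨ht, hfr, h11', h20', V'', hV', hst', hS', hcard'⟩
    refine ⟨ht, h11', by omega, fun i hi => (hfr i hi).trans (kfr i hi),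
      h20'.trans (emptyCountFrom_val ⟨c, km⟩).symm, V'', hV.trans hV', fun f hf hs => ?_, hS',
      by omega⟩
    rcases hf.eq_or_lt with rfl | hlt
    · exact hst' hs
    · exact hV' (hst f hlt hs)
  · exact ⟨h11, le_rfl, fun _ _ => rfl, h20.trans emptyCountFrom_eq_zero.symm, V, le_rfl,
      fun f hf => absurd f.isLt (not_lt.2 hf), h, rfl⟩
  · rintro t τ ⟨ht, h0, k, k11, km, kfr, k20, V', hV, hst, hS, hcard⟩
    obtain rfl : k = 0 := k11.symm.trans h0
    exact ⟨ht, kfr, k20.trans emptyCountFrom_zero, V', hV, fun f => hst f (Nat.zero_le _), hS,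
      hcard⟩

/-- Set `reg 9` to `1` if the word in `reg 10` is a witness. -/
def acceptTest : Prog := .block
  [.op .land 17 10 7, .op .sub 17 7 17, .branch 17 .skip (.block
    [.op .shr 17 10 0, .op .sub 18 17 2, .branch 18 .skip (.block
      [.op .add 18 17 20, .op .sub 18 2 18, .op .mul 18 18 21,
       .branch 18 .skip (.const 9 1)])])]

open Classical in
theorem halts_acceptTest {σ : State} {v : ℕ} (hw : Wide I w) (hc : Consts I d σ)
    (hv : I.WordReach d v) (h10 : σ.reg 10 = v) (h20 : σ.reg 20 = I.emptyCount) :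
    Halts w acceptTest σ fun t τ => t ≤ 11 ∧ τ.mem = σ.mem ∧
      (∀ i, i ≤ 8 ∨ i = 21 → τ.reg i = σ.reg i) ∧
      τ.reg 9 = if I.AcceptsWord d v then 1 else σ.reg 9 := by
  have hsum := hw.sum
  have hsp := hw.space
  have hvlt := hv.lt
  have hj := hv.reach.le_n
  have hempty : I.emptyCount ≤ I.m := by
    simpa [emptyCount] using Finset.card_filter_le Finset.univ fun f => I.nbhd f = ∅
  have hmask : 2 ^ I.n - 1 < 2 ^ w :=
    (Nat.sub_lt (by positivity) one_pos).trans_le (Nat.pow_le_pow_right (by norm_num) hw.le)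
  have e1 : (v &&& (2 ^ I.n - 1)) % 2 ^ w = v &&& (2 ^ I.n - 1) :=
    Nat.mod_eq_of_lt (Nat.and_le_right.trans_lt hmask)
  have e2 : (2 ^ I.n - 1 - (v &&& (2 ^ I.n - 1))) % 2 ^ w ≠ 0 ↔ ¬ I.lowSet v = Finset.univ := by
    rw [Nat.mod_eq_of_lt ((Nat.sub_le _ _).trans_lt hmask), ne_eq, sub_and_mask_eq_zero_iff]
  have e3 : (v >>> I.n) % 2 ^ w = v >>> I.n := Nat.mod_eq_of_lt (by omega)
  have e4 : (v >>> I.n - I.s) % 2 ^ w ≠ 0 ↔ ¬ v >>> I.n ≤ I.s := by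
    rw [Nat.mod_eq_of_lt (by omega), ne_eq, Nat.sub_eq_zero_iff_le]
  have e5 : (v >>> I.n + I.emptyCount) % 2 ^ w = v >>> I.n + I.emptyCount :=
    Nat.mod_eq_of_lt (by omega)
  have e6 : (I.s - (v >>> I.n + I.emptyCount)) % 2 ^ w * d.toNat % 2 ^ w ≠ 0 ↔
      ¬ (d = true → I.s ≤ v >>> I.n + I.emptyCount) := by
    have : (I.s - (v >>> I.n + I.emptyCount)) % 2 ^ w = I.s - (v >>> I.n + I.emptyCount) :=
      Nat.mod_eq_of_lt (by omega)
    rw [this]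
    cases d
    · simp
    · simp [this, Nat.sub_eq_zero_iff_le]
  have e7 : 1 % 2 ^ w = 1 := Nat.mod_eq_of_lt (by omega)
  have hfr : ∀ i, i ≤ 8 ∨ i = 21 → i ≠ 9 ∧ i ≠ 17 ∧ i ≠ 18 ∧ i ≠ 19 := by omega
  simp only [acceptTest, Prog.block, Prog.skip, halts_seq, halts_op, halts_const, halts_branch,
    Op.eval, reg_setReg, mem_setReg, Nat.reduceEqDiff, if_true, if_false, hc.r0, hc.r2, hc.r7,
    hc.r21, h10, h20, e1, e2, e3, e4, e5, e6, e7, ← Nat.add_assoc, Nat.reduceAdd]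
  by_cases h1 : I.lowSet v = Finset.univ
  · by_cases h2 : v >>> I.n ≤ I.s
    · by_cases h3 : d = true → I.s ≤ v >>> I.n + I.emptyCount
      · rw [if_neg (not_not.2 h1), if_neg (not_not.2 h2), if_neg (not_not.2 h3),
          if_pos (show I.AcceptsWord d v from ⟨h1, h2, h3⟩)]
        refine ⟨by norm_num, trivial, fun i hi => ?_, rfl⟩
        obtain ⟨i1, i2, i3, i4⟩ := hfr i hi
        simp only [i1, i2, i3, if_false]
      · rw [if_neg (not_not.2 h1), if_neg (not_not.2 h2), if_pos h3,
          if_neg (show ¬ I.AcceptsWord d v from fun h => h3 h.2.2)]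
        refine ⟨by norm_num, trivial, fun i hi => ?_, rfl⟩
        obtain ⟨i1, i2, i3, i4⟩ := hfr i hi
        simp only [i2, i3, i4, if_false]
    · rw [if_neg (not_not.2 h1), if_pos h2,
        if_neg (show ¬ I.AcceptsWord d v from fun h => h2 h.2.1)]
      refine ⟨by norm_num, trivial, fun i hi => ?_, rfl⟩
      obtain ⟨i1, i2, i3, i4⟩ := hfr i hi
      simp only [i2, i3, i4, if_false]
  · rw [if_pos h1, if_neg (show ¬ I.AcceptsWord d v from fun h => h1 h.1)]
    refine ⟨by norm_num, trivial, fun i hi => ?_, rfl⟩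
    obtain ⟨i1, i2, i3, i4⟩ := hfr i hi
    simp only [i2, i4, if_false]

/-- Pop a word from the stack and process it. -/
def popBody : Prog := .block
  [.op .sub 8 8 3, .op .add 17 5 8, .load 10 17, .const 20 0, .op .lor 11 1 1,
   .loop 11 visitBody, acceptTest]

theorem halts_popBody {σ : State} {V : Finset ℕ} (hw : Wide I w) (hc : Consts I d σ)
    (h8 : σ.reg 8 ≠ 0) (h : Search I d σ.mem (σ.reg 8) (σ.reg 9) V fun _ => False) :
    Halts w popBody σ fun t τ => t ≤ I.m * (12 * I.n + 41) + 40 ∧ Consts I d τ ∧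
      ∃ V', Search I d τ.mem (τ.reg 8) (τ.reg 9) V' (fun _ => False) ∧
        τ.reg 8 + V.card + 1 = σ.reg 8 + V'.card := by
  obtain ⟨sp, hsp⟩ := Nat.exists_eq_succ_of_ne_zero h8
  rw [Nat.succ_eq_add_one] at hsp
  rw [hsp] at h
  have hsum := hw.sum
  have hspace := hw.space
  have hle := (h.height_le.trans (Finset.card_le_card h.subset)).trans card_reachable_le_two_pow
  have e1 : (sp + 1 - 1) % 2 ^ w = sp := by simpa using Nat.mod_eq_of_lt (by omega)
  have e2 : (I.m * I.n + 2 ^ (2 * I.n) + sp) % 2 ^ w = I.m * I.n + 2 ^ (2 * I.n) + sp :=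
    Nat.mod_eq_of_lt (by omega)
  have e3 : I.m % 2 ^ w = I.m := Nat.mod_eq_of_lt (by omega)
  set v := σ.mem (I.m * I.n + 2 ^ (2 * I.n) + sp) with hv
  have hvV : v ∈ V := h.stack sp (Nat.lt_succ_self _)
  simp only [popBody, Prog.block, halts_seq, halts_op, halts_const, halts_load, Op.eval, reg_setReg,
    mem_setReg, Nat.reduceEqDiff, if_true, if_false, hc.r1, hc.r3, hc.r5, hsp, e1, e2, e3, ← hv,
    Nat.zero_mod, Nat.or_self]
  have hfr : ∀ i, i ≤ 7 ∨ i = 9 ∨ i = 21 → i ≠ 8 ∧ i ≠ 10 ∧ i ≠ 11 ∧ i ≠ 17 ∧ i ≠ 20 := by omega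
  refine (halts_visit (v := v) (ans := σ.reg 9) (V := V) (ex := fun v' => v' = v) hw
    (hc.frame fun i hi => ?_) (h.subset hvV) ?_ ?_ ?_ ?_).mono ?_
  · obtain ⟨i1, i2, i3, i4, i5⟩ := hfr i (by omega)
    simp only [reg_setReg, i1, i2, i3, i4, i5, if_false]
  · simp [reg_setReg]
  · simp [reg_setReg]
  · simp [reg_setReg]
  · simpa [reg_setReg, mem_setReg] using h.pop
  rintro t τ ⟨ht, hfr', h20, V', hV, hst, hS, hcard⟩
  simp only [reg_setReg, Nat.reduceEqDiff, if_true, if_false] at hcard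
  have g10 : τ.reg 10 = v := by rw [hfr' 10 (by norm_num)]; simp [reg_setReg]
  have g : ∀ i, i ≤ 7 ∨ i = 9 ∨ i = 21 → τ.reg i = σ.reg i := by
    intro i hi
    rw [hfr' i (by omega)]
    obtain ⟨i1, i2, i3, i4, i5⟩ := hfr i hi
    simp only [reg_setReg, i1, i2, i3, i4, i5, if_false]
  have hc' : Consts I d τ := hc.frame fun i hi => g i (by omega)
  have hvr := mem_reachable.1 (h.subset hvV)
  refine (halts_acceptTest hw hc' hvr g10 h20).mono ?_
  rintro t' ρ ⟨ht', hm', hfr'', h9⟩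
  refine ⟨by omega, hc'.frame fun i hi => hfr'' i (by omega), V', ?_, ?_⟩
  · rw [hm', hfr'' 8 (by norm_num), h9, g 9 (by norm_num)]
    refine hS.mono ?_ ?_ ?_
    · split_ifs with ha
      exacts [Or.inr ⟨rfl, v, hvr, ha⟩, hS.sound]
    · intro h1; rw [h1, ite_self]
    · rintro v' hv' rfl
      exact Or.inr ⟨hst, fun ha => if_pos ha⟩
  · rw [hfr'' 8 (by norm_num)]; omega

/-! ### The complete program, its running time and the word length. -/

/-- The program that solves Set Cover (`d = false`) and Set Partition (`d = true`). -/
def solver (d : Bool) : Prog := .block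
  [.const 3 1, .op .mul 4 1 0, .op .shl 6 3 0, .op .sub 7 6 3, .op .mul 17 6 6, .op .add 5 4 17,
   .const 21 d.toNat, .store 4 3, .const 8 1, .loop 8 popBody, .op .lor 0 9 9]

theorem input_matrix (f : Fin I.m) (u : Fin I.n) :
    (input I).mem (f * I.n + u) = (I.edge f u).toNat := by
  simp only [input]
  cases h : I.edge f u
  · rw [if_neg, Bool.toNat_false]
    rintro ⟨f', u', heq, he⟩
    have hn : 0 < I.n := u.pos
    have hu : u = u' := Fin.ext (by
      have := congrArg (· % I.n) heq
      simpa [Nat.mod_eq_of_lt u.isLt, Nat.mod_eq_of_lt u'.isLt] using this)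
    subst hu
    have hf : f = f' := Fin.ext (Nat.eq_of_mul_eq_mul_right hn (Nat.add_right_cancel heq))
    subst hf
    rw [h] at he
    exact absurd he (by simp)
  · rw [if_pos ⟨f, u, rfl, h⟩, Bool.toNat_true]

theorem input_mem_of_le {a : ℕ} (h : I.m * I.n ≤ a) : (input I).mem a = 0 := by
  simp only [input]
  rw [if_neg]
  rintro ⟨f, u, rfl, -⟩
  have : f.val * I.n + u.val < I.m * I.n := by
    calc f.val * I.n + u.val < (f.val + 1) * I.n := by rw [Nat.succ_mul]; omega
      _ ≤ I.m * I.n := Nat.mul_le_mul_right _ f.isLt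
  omega

theorem search_input :
    Search I d (Function.update (input I).mem (I.m * I.n) 1) 1 0 {0} fun _ => False := by
  have hpos := Nat.two_pow_pos (2 * I.n)
  refine ⟨fun f u => ?_, fun v _ => ?_, fun i _ => ?_, fun v hv => ?_, ?_, by simp, by simp,
    Or.inl rfl⟩
  · have : f.val * I.n + u.val < I.m * I.n := by
      calc f.val * I.n + u.val < (f.val + 1) * I.n := by rw [Nat.succ_mul]; omega
        _ ≤ I.m * I.n := Nat.mul_le_mul_right _ f.isLt
    rw [Function.update_of_ne (by omega), input_matrix]
  · rcases Nat.eq_zero_or_pos v with rfl | hv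
    · simp
    · rw [Function.update_of_ne (by omega), input_mem_of_le (by omega)]
      simp [hv.ne']
  · rw [Function.update_of_ne (by omega), input_mem_of_le (by omega)]
    simp
  -- Fresh memory is zero, so the bottom stack cell already holds the initial word `0` and the table
  -- needs no clearing, which would take `2 ^ (2 * n)` steps.
  · refine Or.inl ⟨0, one_pos, ?_⟩
    rw [Function.update_of_ne (by omega), input_mem_of_le (by omega), Finset.mem_singleton.1 hv]
  · exact Finset.singleton_subset_iff.2 (mem_reachable.2 .zero)

theorem halts_solver (hw : Wide I w) :
    Halts w (solver d) (input I) fun t τ =>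
      t ≤ (I.reachable d).card * (I.m * (12 * I.n + 41) + 41) + 30 ∧
        ((∃ v, I.WordReach d v ∧ I.AcceptsWord d v) → τ.reg 0 = 1) ∧
        (¬ (∃ v, I.WordReach d v ∧ I.AcceptsWord d v) → τ.reg 0 = 0) := by
  have hsum := hw.sum
  have hspace := hw.space
  have hpos := Nat.two_pow_pos I.n
  have hpos2 : 2 ^ I.n ≤ 2 ^ (2 * I.n) := Nat.pow_le_pow_right (by norm_num) (by omega)
  have hsq : 2 ^ I.n * 2 ^ I.n = 2 ^ (2 * I.n) := by rw [two_mul, pow_add]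
  have e1 : 1 % 2 ^ w = 1 := Nat.mod_eq_of_lt (by omega)
  have e2 : I.m * I.n % 2 ^ w = I.m * I.n := Nat.mod_eq_of_lt (by omega)
  have e3 : 2 ^ I.n % 2 ^ w = 2 ^ I.n := Nat.mod_eq_of_lt (by omega)
  have e4 : (2 ^ I.n - 1) % 2 ^ w = 2 ^ I.n - 1 := Nat.mod_eq_of_lt (by omega)
  have e5 : 2 ^ (2 * I.n) % 2 ^ w = 2 ^ (2 * I.n) := Nat.mod_eq_of_lt (by omega)
  have e6 : (I.m * I.n + 2 ^ (2 * I.n)) % 2 ^ w = I.m * I.n + 2 ^ (2 * I.n) :=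
    Nat.mod_eq_of_lt (by omega)
  have e7 : d.toNat % 2 ^ w = d.toNat := toNat_mod_two_pow (by omega) d
  have i0 : (input I).reg 0 = I.n := rfl
  have i1 : (input I).reg 1 = I.m := rfl
  have i2 : (input I).reg 2 = I.s := rfl
  have i9 : (input I).reg 9 = 0 := rfl
  simp only [solver, Prog.block, halts_seq, halts_op, halts_const, halts_store, Op.eval, reg_setReg,
    Nat.reduceEqDiff, if_true, if_false, i0, i1, e1, e2, Nat.shiftLeft_eq,
    one_mul, e3, e4, hsq, e5, e6, e7]
  -- The measure is the stack height plus the number of reachable words not yet found. A push leaves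
  -- it unchanged and a pop lowers it by one, so each reachable word is expanded at most once.
  let J : ℕ → State → Prop := fun k τ => Consts I d τ ∧
    ∃ V, Search I d τ.mem (τ.reg 8) (τ.reg 9) V (fun _ => False) ∧
      k + V.card = τ.reg 8 + (I.reachable d).card
  refine (halts_loop (D := I.m * (12 * I.n + 41) + 40) J ?_ (I.reachable d).card _ ?_).mono ?_
  · rintro k τ ⟨hc, V, hS, hk⟩ h8
    have hVR := Finset.card_le_card hS.subset
    obtain ⟨k', rfl⟩ : ∃ k', k = k' + 1 := Nat.exists_eq_succ_of_ne_zero (by omega)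
    refine ⟨k', rfl, (halts_popBody hw hc h8 hS).mono ?_⟩
    rintro t ρ ⟨ht, hc', V', hS', hcard⟩
    exact ⟨ht, hc', V', hS', by omega⟩
  · refine ⟨?_, {0}, ?_, ?_⟩
    · constructor <;> simp [reg_setReg, reg_setMem, i0, i1, i2]
    · simpa [reg_setReg, reg_setMem, mem_setReg, mem_setMem, i9] using search_input
    · simp [reg_setReg]; omega
  · rintro t τ ⟨ht, h0, k, hc, V, hS, -⟩
    rw [h0] at hS
    have h9 : τ.reg 9 % 2 ^ w = τ.reg 9 := Nat.mod_eq_of_lt (by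
      rcases hS.sound with h | h <;> omega)
    have ht' : t ≤ (I.reachable d).card * (I.m * (12 * I.n + 41) + 41) + 1 := ht
    simp only [Nat.or_self, h9]
    exact ⟨by omega, hS.answer⟩

/-- With the factor `4`, each of the at most four summands in a required bound is at most a quarter
of `2 ^ w`. -/
theorem wide_of_le (h : 4 * (I.n + Nat.size I.m + Nat.size I.s + 1) ≤ w) : Wide I w := by
  have hm := Nat.lt_size_self I.m
  have hs := Nat.lt_size_self I.s
  have hn := Nat.lt_two_pow_self (n := I.n)
  have hp : ∀ a, a + 2 ≤ w → 4 * 2 ^ a ≤ 2 ^ w := fun a ha => by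
    calc 4 * 2 ^ a = 2 ^ (a + 2) := by rw [pow_add]; ring
      _ ≤ 2 ^ w := Nat.pow_le_pow_right (by norm_num) ha
  refine ⟨?_, ?_, by omega⟩
  · have h1 : I.m * I.n ≤ 2 ^ (Nat.size I.m + I.n) := by
      rw [pow_add]; exact Nat.mul_le_mul hm.le hn.le
    have h2 := hp (Nat.size I.m + I.n) (by omega)
    have h3 := hp (2 * I.n) (by omega)
    omega
  · have h1 := hp (Nat.size I.m) (by omega)
    have h2 := hp (Nat.size I.s) (by omega)
    have h3 := hp I.n (by omega)
    have h4 := hp 1 (by omega)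
    omega

theorem solvableInTime {P : CoverInstance → Prop} (d : Bool)
    (hP : ∀ I : CoverInstance, P I ↔ ∃ j, Reach I d j Finset.univ ∧ I.Accepts d j) :
    SolvableInTime P
      (fewSetsTime 448 ((Polynomial.X + 1) * (12 * Polynomial.X + 82) + 30)) := by
  refine ⟨solver d, 4, fun I w h => ?_⟩
  obtain ⟨t, τ, he, ht, h1, h0⟩ := halts_solver (d := d) (wide_of_le h)
  rw [hP, ← exists_acceptsWord_iff]
  exact ⟨t, τ, he, h1, h0, time_le t ht⟩

end WordRAM

theorem mainTheorem8 :
    (∃ (C : ℝ) (q : Polynomial ℕ), 0 < C ∧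
      WordRAM.SolvableInTime CoverInstance.HasSetCover (fewSetsTime C q)) ∧
    (∃ (C : ℝ) (q : Polynomial ℕ), 0 < C ∧
      WordRAM.SolvableInTime CoverInstance.HasSetPartition (fewSetsTime C q)) :=
  ⟨⟨448, _, by norm_num, WordRAM.solvableInTime false fun _ => CoverInstance.hasSetCover_iff⟩,
    ⟨448, _, by norm_num, WordRAM.solvableInTime true fun _ =>
      CoverInstance.hasSetPartition_iff⟩⟩
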